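/- Let $n\ge 2$. For a measurable bounded set $U\subset\mathbb{R}^{n-1}$ and a function $\psi$ that is continuous on $U$, let $\mathcal{M}^\psi=\{(\xi,\psi(\xi)):\xi\in U\}\subset\mathbb{R}^n$, and let $\sigma^\psi$ be the measure on $\mathcal{M}^\psi$ given by $\sigma^\psi(A)=|\{\xi\in U:(\xi,\psi(\xi))\in A\}|$, where $|\cdot|$ is Lebesgue measure on $\mathbb{R}^{n-1}$. For $1\le p,q\le\infty$ one says that $R_{\mathcal{M}^\psi}(p\mapsto q)$ holds if there is a constant $C$ such that $$\|\widehat f\,\|_{L^q(\mathcal{M}^\psi,\,d\sigma^\psi)}\le C\,\|f\|_{L^p(\mathbb{R}^n)}\qquad\text{for all Schwartz functions } f\in\mathcal{S}(\mathbb{R}^n),$$ where $\widehat f(\xi)=\int_{\mathbb{R}^n}f(x)e^{-2\pi i x\cdot\xi}\,dx$. **Theorem (Stein–Tomas).** Let $1\le p\le\frac{2(n+1)}{n+3}$. Then $R_{\mathcal{M}^\psi}(p\mapsto 2)$ holds in each of the following cases: 1. $\mathcal{M}^\psi$ is the truncated paraboloid, that is, $U=(-1,1)^{n-1}$ and $\psi(\xi)=\sum_{j=1}^{n-1}\xi_j^2$;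 2. $\mathcal{M}^\psi$ is one of the two open unit hemispheres, that is, $U=\{\xi\in\mathbb{R}^{n-1}:|\xi|<1\}$ and $\psi(\xi)=\sqrt{1-|\xi|^2}$ or $\psi(\xi)=-\sqrt{1-|\xi|^2}$; 3. $U\subset\mathbb{R}^{n-1}$ is measurable and bounded, $\psi$ is a real-valued $C^\infty$ function on an open set containing the closure $\overline U$, and the Gaussian curvature $\det D^2\psi(\xi)\,(1+|\nabla\psi(\xi)|^2)^{-(n+1)/2}$ of its graph is nonzero at every $\xi\in\overline U$. -/

import Mathlib

open MeasureTheory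
open scoped ENNReal NNReal ContDiff FourierTransform SchwartzMap Gradient

noncomputable section

namespace FourierRestriction

/-- The point `(ξ, ψ(ξ))` of `ℝ^(d+1)` on the graph of `ψ : ℝ^d → ℝ`. -/
def graphPoint {d : ℕ} (ψ : EuclideanSpace ℝ (Fin d) → ℝ) (ξ : EuclideanSpace ℝ (Fin d)) :
    EuclideanSpace ℝ (Fin (d + 1)) :=
  WithLp.toLp 2 (Fin.snoc (α := fun _ => ℝ) (fun j => ξ j) (ψ ξ))

/-- The hypersurface `{(ξ, ψ(ξ)) : ξ ∈ U}` of `ℝ^(d+1)`. -/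
def graphSurface {d : ℕ} (U : Set (EuclideanSpace ℝ (Fin d)))
    (ψ : EuclideanSpace ℝ (Fin d) → ℝ) : Set (EuclideanSpace ℝ (Fin (d + 1))) :=
  graphPoint ψ '' U

/-- The projection `(ξ, t) ↦ ξ` from `ℝ^(d+1)` to `ℝ^d`. -/
def baseProj {d : ℕ} (x : EuclideanSpace ℝ (Fin (d + 1))) : EuclideanSpace ℝ (Fin d) :=
  WithLp.toLp 2 (fun j => x j.castSucc)

/-- The measure on the surface `{(ξ, ψ(ξ)) : ξ ∈ U}` that corresponds to Lebesgue measure on `U`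
under the projection, as a measure on `ℝ^(d+1)` carried by the surface
(see `graphMeasure_apply`). -/
def graphMeasure {d : ℕ} (U : Set (EuclideanSpace ℝ (Fin d)))
    (ψ : EuclideanSpace ℝ (Fin d) → ℝ) : Measure (EuclideanSpace ℝ (Fin (d + 1))) :=
  (volume.restrict U).map (graphPoint ψ)

/-- The measure of a Borel set is the Lebesgue measure of the projection of its part on the
surface. -/
theorem graphMeasure_apply {d : ℕ} {U : Set (EuclideanSpace ℝ (Fin d))}
    {ψ : EuclideanSpace ℝ (Fin d) → ℝ} (hU : MeasurableSet U) (hψ : ContinuousOn ψ U)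
    {A : Set (EuclideanSpace ℝ (Fin (d + 1)))} (hA : MeasurableSet A) :
    graphMeasure U ψ A = volume (baseProj '' (A ∩ graphSurface U ψ)) := by
  have hcont : ContinuousOn (graphPoint ψ) U := by
    refine (PiLp.continuous_toLp 2 _).comp_continuousOn (continuousOn_pi.2 fun j => ?_)
    refine Fin.lastCases ?_ (fun i => ?_) j
    · simpa using hψ
    · simp only [Fin.snoc_castSucc]
      fun_prop
  have hset : baseProj '' (A ∩ graphSurface U ψ) = graphPoint ψ ⁻¹' A ∩ U := by
    have hproj : ∀ ξ, baseProj (graphPoint ψ ξ) = ξ := by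
      intro ξ
      ext j
      simp [baseProj, graphPoint]
    ext ξ
    constructor
    · rintro ⟨_, ⟨hx, η, hη, rfl⟩, rfl⟩
      rw [hproj]
      exact ⟨hx, hη⟩
    · rintro ⟨h1, h2⟩
      exact ⟨graphPoint ψ ξ, ⟨h1, ξ, h2, rfl⟩, hproj ξ⟩
  rw [graphMeasure, Measure.map_apply_of_aemeasurable (hcont.aemeasurable hU) hA,
    Measure.restrict_apply' hU, hset]

/-- The restriction estimate `R(p ↦ q)` for a measure `σ` on `ℝ^n`:
`‖f̂‖_{L^q(σ)} ≤ C ‖f‖_{L^p(ℝ^n)}` for all Schwartz functions `f`, with `C` independent of `f`.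
Here `f̂(ξ) = ∫ f(x) e^{-2πi x·ξ} dx`. -/
def RestrictionEstimate {n : ℕ} (σ : Measure (EuclideanSpace ℝ (Fin n))) (p q : ℝ≥0∞) : Prop :=
  ∃ C : ℝ≥0, ∀ f : 𝓢(EuclideanSpace ℝ (Fin n), ℂ),
    eLpNorm (𝓕 (f : EuclideanSpace ℝ (Fin n) → ℂ)) q σ
      ≤ C * eLpNorm (f : EuclideanSpace ℝ (Fin n) → ℂ) p volume

/-- The Hessian matrix of second partial derivatives of `ψ` at `ξ`. -/
def hessian {d : ℕ} (ψ : EuclideanSpace ℝ (Fin d) → ℝ) (ξ : EuclideanSpace ℝ (Fin d)) :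
    Matrix (Fin d) (Fin d) ℝ :=
  Matrix.of fun j k =>
    fderiv ℝ (fun η => fderiv ℝ ψ η (EuclideanSpace.single k 1)) ξ (EuclideanSpace.single j 1)

/-- The Gaussian curvature (product of the principal curvatures) of the graph of `ψ` at
`(ξ, ψ(ξ))`, namely `det D²ψ(ξ) / (1 + |∇ψ(ξ)|²)^((d+2)/2)`; at a point where `∇ψ(ξ) = 0` this is
the product of the eigenvalues of the Hessian. -/
def gaussianCurvature {d : ℕ} (ψ : EuclideanSpace ℝ (Fin d) → ℝ)
    (ξ : EuclideanSpace ℝ (Fin d)) : ℝ :=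
  (hessian ψ ξ).det / (1 + ‖∇ ψ ξ‖ ^ 2) ^ (((d : ℝ) + 2) / 2)

/-- The open cube `(-1,1)^d`. -/
def openCube (d : ℕ) : Set (EuclideanSpace ℝ (Fin d)) := {ξ | ∀ j, |ξ j| < 1}

/-- The function whose graph over the open cube is the truncated paraboloid. -/
def paraboloid {d : ℕ} (ξ : EuclideanSpace ℝ (Fin d)) : ℝ := ∑ j, ξ j ^ 2

/-- The function whose graph over the open unit ball is the open upper unit hemisphere. -/
def hemisphere {d : ℕ} (ξ : EuclideanSpace ℝ (Fin d)) : ℝ := √(1 - ‖ξ‖ ^ 2)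

/-- The exponent `2(n+1)/(n+3)` for hypersurfaces in `ℝ^n`. -/
def steinTomasExponent (n : ℕ) : ℝ := 2 * ((n : ℝ) + 1) / ((n : ℝ) + 3)

end FourierRestriction

end

/-! Write `d = n - 1`. By the `T T*` argument, the integral of `a |𝓕 f|²` over the graph is a
bilinear form in `f` and its conjugate, whose kernel `K` is the Fourier transform of the density
`a(ξ) dξ` carried by the graph. The restriction estimate for a small piece is an `Lᵖ × Lᵖ` bound for
this form.

The curvature enters only through the decay `|K(y)| ≤ C |y_last|^(-d/2)`, proved without a normal
form for the phase. Expanding the square of the oscillatory integral as a double integral over `ξ`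
and an increment `h` removes every linear term of the phase from the modulus. The remaining phase `t
(ψ(ξ + h) - ψ(ξ))` has gradient of size at least `c |t| |h|`, because the Hessian is invertible, so
repeated integration by parts gives the factor `(1 + |t| |h|)^(-(d+1))`, whose integral in `h` is a
multiple of `|t|^(-d)` (`exists_oscillatory_decay`).

The endpoint exponent comes from Stein's complex interpolation in a discrete form. Split `1 = ∑
φ_j(y_last)` dyadically and give the pieces complex coefficients. With moduli `2^(-j)` the kernel is
the Fourier transform of a bounded function, which gives `L² × L²`; with moduli `2^(jβ)`, `β ≤ d/2`,
the decay makes it bounded, which gives `L¹ × L¹`. At `θ = 2/p - 1` and `β = (1 - θ)/θ` the weights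
cancel (`stein_interpolation`, `exists_dyadic_resolution`, `exists_bilinear_bound`), and `β ≤ d/2`
is exactly the condition on `p`.

Compactness of `closure U` patches local estimates together, which settles the curved graphs and the
paraboloid. The hemisphere becomes vertical at its boundary; there it is covered by caps that a
coordinate swap and a reflection carry into a compact part of the open hemisphere
(`graphEstimate_hemisphere_sideCap`). -/

namespace FourierRestriction

/-! ### Oscillatory integrals without critical points, uniformly in families. -/

section NonstationaryPhase

variable {E : Type*} [NormedAddCommGroup E] [NormedSpace ℝ E] {ι : Type*}

/-- The functions of the family `u` and their first `k` derivatives in the direction `e` are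
bounded on `O`, uniformly in the family. -/
def UniformDerivBound (O : Set E) (e : E) : ℕ → (ι → E → ℂ) → Prop
  | 0, u => ∃ C : ℝ, ∀ i, ∀ ξ ∈ O, ‖u i ξ‖ ≤ C
  | k + 1, u => (∃ C : ℝ, ∀ i, ∀ ξ ∈ O, ‖u i ξ‖ ≤ C) ∧
      UniformDerivBound O e k (fun i ξ => fderiv ℝ (u i) ξ e)

namespace UniformDerivBound

variable {O : Set E} {e : E} {k : ℕ} {u v : ι → E → ℂ}

theorem bound (h : UniformDerivBound O e k u) : ∃ C : ℝ, ∀ i, ∀ ξ ∈ O, ‖u i ξ‖ ≤ C := by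
  cases k with
  | zero => exact h
  | succ k => exact h.1

theorem of_succ : ∀ {k : ℕ} {u : ι → E → ℂ},
    UniformDerivBound O e (k + 1) u → UniformDerivBound O e k u
  | 0, _, h => h.1
  | _ + 1, _, h => ⟨h.1, of_succ h.2⟩

theorem congr (hO : IsOpen O) : ∀ {k : ℕ} {u v : ι → E → ℂ},
    UniformDerivBound O e k u → (∀ i, ∀ ξ ∈ O, v i ξ = u i ξ) → UniformDerivBound O e k v
  | 0, u, v, ⟨C, hC⟩, huv => ⟨C, fun i ξ hξ => by rw [huv i ξ hξ]; exact hC i ξ hξ⟩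
  | k + 1, u, v, ⟨⟨C, hC⟩, hk⟩, huv => by
    refine ⟨⟨C, fun i ξ hξ => by rw [huv i ξ hξ]; exact hC i ξ hξ⟩, congr hO hk ?_⟩
    intro i ξ hξ
    have : v i =ᶠ[nhds ξ] u i := by
      filter_upwards [hO.mem_nhds hξ] with η hη using huv i η hη
    rw [this.fderiv_eq]

theorem add (hO : IsOpen O) : ∀ {k : ℕ} {u v : ι → E → ℂ}, (∀ i, ContDiffOn ℝ ∞ (u i) O) →
    (∀ i, ContDiffOn ℝ ∞ (v i) O) → UniformDerivBound O e k u → UniformDerivBound O e k v →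
    UniformDerivBound O e k (fun i ξ => u i ξ + v i ξ) := by
  have key : ∀ {u v : ι → E → ℂ}, (∃ C : ℝ, ∀ i, ∀ ξ ∈ O, ‖u i ξ‖ ≤ C) →
      (∃ C : ℝ, ∀ i, ∀ ξ ∈ O, ‖v i ξ‖ ≤ C) → ∃ C : ℝ, ∀ i, ∀ ξ ∈ O, ‖u i ξ + v i ξ‖ ≤ C := by
    rintro u v ⟨C, hC⟩ ⟨D, hD⟩
    exact ⟨C + D, fun i ξ hξ => norm_add_le_of_le (hC i ξ hξ) (hD i ξ hξ)⟩
  intro k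
  induction k with
  | zero => exact fun _ _ hu hv => key hu hv
  | succ k ih =>
    intro u v su sv hu hv
    refine ⟨key hu.1 hv.1, congr hO (ih ?_ ?_ hu.2 hv.2) ?_⟩
    · exact fun i => ((su i).fderiv_of_isOpen hO (by simp)).clm_apply contDiffOn_const
    · exact fun i => ((sv i).fderiv_of_isOpen hO (by simp)).clm_apply contDiffOn_const
    · intro i ξ hξ
      have h1 := ((su i).contDiffAt (hO.mem_nhds hξ)).differentiableAt (by simp)
      have h2 := ((sv i).contDiffAt (hO.mem_nhds hξ)).differentiableAt (by simp)
      rw [fderiv_fun_add h1 h2]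
      rfl

theorem mul (hO : IsOpen O) : ∀ {k : ℕ} {u v : ι → E → ℂ}, (∀ i, ContDiffOn ℝ ∞ (u i) O) →
    (∀ i, ContDiffOn ℝ ∞ (v i) O) → UniformDerivBound O e k u → UniformDerivBound O e k v →
    UniformDerivBound O e k (fun i ξ => u i ξ * v i ξ) := by
  have key : ∀ {u v : ι → E → ℂ}, (∃ C : ℝ, ∀ i, ∀ ξ ∈ O, ‖u i ξ‖ ≤ C) →
      (∃ C : ℝ, ∀ i, ∀ ξ ∈ O, ‖v i ξ‖ ≤ C) → ∃ C : ℝ, ∀ i, ∀ ξ ∈ O, ‖u i ξ * v i ξ‖ ≤ C := by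
    rintro u v ⟨C, hC⟩ ⟨D, hD⟩
    refine ⟨C * D, fun i ξ hξ => ?_⟩
    rw [norm_mul]
    exact mul_le_mul (hC i ξ hξ) (hD i ξ hξ) (norm_nonneg _) ((norm_nonneg _).trans (hC i ξ hξ))
  intro k
  induction k with
  | zero => exact fun _ _ hu hv => key hu hv
  | succ k ih =>
    intro u v su sv hu hv
    have du : ∀ i, ContDiffOn ℝ ∞ (fun ξ => fderiv ℝ (u i) ξ e) O :=
      fun i => ((su i).fderiv_of_isOpen hO (by simp)).clm_apply contDiffOn_const
    have dv : ∀ i, ContDiffOn ℝ ∞ (fun ξ => fderiv ℝ (v i) ξ e) O :=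
      fun i => ((sv i).fderiv_of_isOpen hO (by simp)).clm_apply contDiffOn_const
    refine ⟨key hu.1 hv.1, congr hO (add hO (fun i => (su i).mul (dv i))
      (fun i => (sv i).mul (du i)) (ih su dv hu.of_succ hv.2) (ih sv du hv.of_succ hu.2)) ?_⟩
    intro i ξ hξ
    have h1 := ((su i).contDiffAt (hO.mem_nhds hξ)).differentiableAt (by simp)
    have h2 := ((sv i).contDiffAt (hO.mem_nhds hξ)).differentiableAt (by simp)
    rw [fderiv_fun_mul h1 h2]
    simp

/-- The derivative of `u⁻¹` is `-u' u⁻²`, so order `k + 1` reduces to order `k` of `u'` and of `u⁻¹`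
itself. The uniform lower bound on `‖u‖` is needed only at order zero. -/
theorem inv (hO : IsOpen O) {c : ℝ} (hc : 0 < c) (su : ∀ i, ContDiffOn ℝ ∞ (u i) O)
    (huc : ∀ i, ∀ ξ ∈ O, c ≤ ‖u i ξ‖) (hu : ∀ k, UniformDerivBound O e k u) (k : ℕ) :
    UniformDerivBound O e k (fun i ξ => (u i ξ)⁻¹) := by
  have hne : ∀ i, ∀ ξ ∈ O, u i ξ ≠ 0 := fun i ξ hξ =>
    norm_pos_iff.1 (hc.trans_le (huc i ξ hξ))
  have hb : ∃ C : ℝ, ∀ i, ∀ ξ ∈ O, ‖(u i ξ)⁻¹‖ ≤ C := by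
    refine ⟨c⁻¹, fun i ξ hξ => ?_⟩
    rw [norm_inv]
    exact inv_anti₀ hc (huc i ξ hξ)
  have si : ∀ i, ContDiffOn ℝ ∞ (fun ξ => (u i ξ)⁻¹) O := fun i => (su i).inv (hne i)
  have du : ∀ i, ContDiffOn ℝ ∞ (fun ξ => fderiv ℝ (u i) ξ e) O :=
    fun i => ((su i).fderiv_of_isOpen hO (by simp)).clm_apply contDiffOn_const
  have hneg : UniformDerivBound O e k (fun (_ : ι) (_ : E) => (-1 : ℂ)) := by
    have : ∀ k (z : ℂ), UniformDerivBound O e k (fun (_ : ι) (_ : E) => z) := by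
      intro k
      induction k with
      | zero => exact fun z => ⟨‖z‖, fun _ _ _ => le_rfl⟩
      | succ k ih => exact fun z => ⟨⟨‖z‖, fun _ _ _ => le_rfl⟩, by simpa using ih 0⟩
    exact this k _
  induction k with
  | zero => exact hb
  | succ k ih =>
    refine ⟨hb, congr hO (mul hO (fun i => contDiffOn_const) (fun i => (du i).mul
      ((si i).mul (si i))) hneg.of_succ (mul hO du (fun i => (si i).mul (si i)) (hu (k + 1)).2
      (mul hO si si (ih hneg.of_succ) (ih hneg.of_succ)))) ?_⟩
    intro i ξ hξ
    have h1 := ((su i).contDiffAt (hO.mem_nhds hξ)).differentiableAt (by simp)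
    have h2 := (hasDerivAt_inv (hne i ξ hξ)).comp_hasFDerivAt ξ h1.hasFDerivAt
    have h3 : HasFDerivAt (fun ξ => (u i ξ)⁻¹) _ ξ := h2
    rw [h3.fderiv]
    simp
    ring

end UniformDerivBound

/-- A function that is smooth on an open set containing its support is smooth. -/
theorem contDiff_of_tsupport_subset {F : Type*} [NormedAddCommGroup F] [NormedSpace ℝ F]
    {O : Set E} {g : E → F} (hO : IsOpen O) (hg : tsupport g ⊆ O) (sg : ContDiffOn ℝ ∞ g O) :
    ContDiff ℝ ∞ g := by
  refine contDiff_iff_contDiffAt.2 fun ξ => ?_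
  by_cases hξ : ξ ∈ tsupport g
  · exact sg.contDiffAt (hO.mem_nhds (hg hξ))
  · exact contDiffAt_const.congr_of_eventuallyEq (notMem_tsupport_iff_eventuallyEq.1 hξ)

variable [FiniteDimensional ℝ E] [MeasurableSpace E] [BorelSpace E] {μ : Measure E}
  [μ.IsAddHaarMeasure]

/-- An oscillatory integral whose phase has no critical point decays faster than any power of the
frequency, uniformly over a family of phases and amplitudes. -/
theorem exists_nonstationary_bound {O K : Set E} (hO : IsOpen O) (hK : IsCompact K) (hKO : K ⊆ O)
    (e : E) (θ : ι → E → ℝ) (sθ : ∀ i, ContDiff ℝ ∞ (θ i)) {c : ℝ} (hc : 0 < c)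
    (hw : ∀ i, ∀ ξ ∈ O, c ≤ ‖fderiv ℝ (fun η => (θ i η : ℂ)) ξ e‖)
    (hwB : ∀ k, UniformDerivBound O e k fun i ξ => fderiv ℝ (fun η => (θ i η : ℂ)) ξ e) (N : ℕ) :
    ∀ u : ι → E → ℂ, (∀ i, ContDiffOn ℝ ∞ (u i) O) → (∀ i, tsupport (u i) ⊆ K) →
      (∀ k, UniformDerivBound O e k u) →
      ∃ C : ℝ, ∀ i (l : ℝ), |l| ^ N * ‖∫ ξ, Complex.exp (l * θ i ξ * Complex.I) * u i ξ ∂μ‖ ≤ C := by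
  have sθc : ∀ i, ContDiff ℝ ∞ (fun η => (θ i η : ℂ)) := fun i =>
    Complex.ofRealCLM.contDiff.comp (sθ i)
  have dθ : ∀ i, ContDiff ℝ ∞ (fun ξ => fderiv ℝ (fun η => (θ i η : ℂ)) ξ e) := fun i =>
    ((sθc i).fderiv_right (by simp)).clm_apply contDiff_const
  induction N with
  | zero =>
    intro u su hu hB
    obtain ⟨C, hC⟩ := (hB 0).bound
    refine ⟨|C| * μ.real K, fun i l => ?_⟩
    rw [pow_zero, one_mul]
    have hsupp : ∀ ξ ∉ K, Complex.exp (l * θ i ξ * Complex.I) * u i ξ = 0 := fun ξ hξ => by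
      rw [image_eq_zero_of_notMem_tsupport fun h => hξ (hu i h), mul_zero]
    rw [← setIntegral_eq_integral_of_forall_compl_eq_zero hsupp]
    refine norm_setIntegral_le_of_norm_le_const hK.measure_lt_top fun ξ hξ => ?_
    rw [norm_mul, ← Complex.ofReal_mul, Complex.norm_exp_ofReal_mul_I, one_mul]
    exact (hC i ξ (hKO hξ)).trans (le_abs_self _)
  | succ N ih =>
    intro u su hu hB
    set w : ι → E → ℂ := fun i ξ => fderiv ℝ (fun η => (θ i η : ℂ)) ξ e with hwdef
    have hne : ∀ i, ∀ ξ ∈ O, w i ξ ≠ 0 := fun i ξ hξ =>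
      norm_pos_iff.1 (hc.trans_le (hw i ξ hξ))
    have sw : ∀ i, ContDiffOn ℝ ∞ (w i) O := fun i => (dθ i).contDiffOn
    -- Since `∂_e exp(ilθ) = i l w exp(ilθ)`, one integration by parts trades a factor `l` for the
    -- new amplitude `∂_e (u / w)`, which is again supported in `K` with uniform derivative bounds.
    -- This is why the induction runs over all amplitudes at once.
    set g : ι → E → ℂ := fun i ξ => u i ξ * (w i ξ)⁻¹ with hg
    have sgO : ∀ i, ContDiffOn ℝ ∞ (g i) O := fun i => (su i).mul ((sw i).inv (hne i))
    have gB : ∀ k, UniformDerivBound O e k g := fun k =>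
      (hB k).mul hO su (fun i => (sw i).inv (hne i)) (.inv hO hc sw hw hwB k)
    have gK : ∀ i, tsupport (g i) ⊆ K := fun i =>
      (tsupport_mul_subset_left).trans (hu i)
    have sg : ∀ i, ContDiff ℝ ∞ (g i) := fun i =>
      contDiff_of_tsupport_subset hO ((gK i).trans hKO) (sgO i)
    have dg : ∀ i, ContDiff ℝ ∞ (fun ξ => fderiv ℝ (g i) ξ e) := fun i =>
      ((sg i).fderiv_right (by simp)).clm_apply contDiff_const
    have dgK : ∀ i, tsupport (fun ξ => fderiv ℝ (g i) ξ e) ⊆ K := fun i =>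
      (tsupport_fderiv_apply_subset ℝ e).trans (gK i)
    obtain ⟨C, hC⟩ := ih (fun i ξ => fderiv ℝ (g i) ξ e) (fun i => (dg i).contDiffOn) dgK
      (fun k => (gB (k + 1)).2)
    refine ⟨C, fun i l => ?_⟩
    have cg : HasCompactSupport (g i) := hK.of_isClosed_subset (isClosed_tsupport _) (gK i)
    have cdg : HasCompactSupport (fun ξ => fderiv ℝ (g i) ξ e) :=
      hK.of_isClosed_subset (isClosed_tsupport _) (dgK i)
    set F : E → ℂ := fun ξ => Complex.exp (l * θ i ξ * Complex.I) with hF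
    have sF : ContDiff ℝ ∞ F :=
      Complex.contDiff_exp.comp ((contDiff_const.mul (sθc i)).mul contDiff_const)
    have dF : ∀ ξ, fderiv ℝ F ξ e = l * Complex.I * (F ξ * w i ξ) := by
      intro ξ
      have h1 : HasFDerivAt (fun η => (θ i η : ℂ)) _ ξ :=
        ((sθc i).differentiable (by simp) ξ).hasFDerivAt
      have h2 := (((h1.const_mul (l : ℂ)).mul_const Complex.I).cexp).fderiv
      rw [hF, h2]
      simp [hwdef]
      ring
    have cdF : Continuous fun ξ => fderiv ℝ F ξ e :=
      (((sF.fderiv_right (m := ∞) (by simp)).clm_apply contDiff_const).continuous)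
    have ibp := integral_mul_fderiv_eq_neg_fderiv_mul_of_integrable (μ := μ) (f := F) (g := g i)
      (v := e) ((cdF.mul (sg i).continuous).integrable_of_hasCompactSupport cg.mul_left)
      ((sF.continuous.mul (dg i).continuous).integrable_of_hasCompactSupport cdg.mul_left)
      ((sF.continuous.mul (sg i).continuous).integrable_of_hasCompactSupport cg.mul_left)
      (fun x _ => sF.differentiable (by simp) x) (fun x _ => (sg i).differentiable (by simp) x)
    have h3 : ∫ ξ, fderiv ℝ F ξ e * g i ξ ∂μ = l * Complex.I * ∫ ξ, F ξ * u i ξ ∂μ := by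
      rw [← integral_const_mul]
      refine integral_congr_ae (.of_forall fun ξ => ?_)
      simp only [dF, hg]
      by_cases hξ : ξ ∈ O
      · have := hne i ξ hξ
        field_simp
      · rw [image_eq_zero_of_notMem_tsupport fun h => hξ (hKO (hu i h))]
        simp
    have h4 : |l| * ‖∫ ξ, F ξ * u i ξ ∂μ‖ = ‖∫ ξ, F ξ * fderiv ℝ (g i) ξ e ∂μ‖ := by
      rw [ibp, h3]
      simp
    calc |l| ^ (N + 1) * ‖∫ ξ, F ξ * u i ξ ∂μ‖
        = |l| ^ N * (|l| * ‖∫ ξ, F ξ * u i ξ ∂μ‖) := by ring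
      _ ≤ C := by rw [h4]; exact hC i l

end NonstationaryPhase

/-! ### Decay of oscillatory integrals with nondegenerate Hessian. -/

section Decay

/-- Translation commutes with differentiation, and compact support makes each derivative bounded on
the whole space, so the shift does not affect the constants. -/
theorem UniformDerivBound.translate {E ι : Type*} [NormedAddCommGroup E] [NormedSpace ℝ E]
    (O : Set E) (e : E) (H : ι → E) (k : ℕ) :
    ∀ {a : E → ℂ}, ContDiff ℝ ∞ a → HasCompactSupport a →
      UniformDerivBound O e k fun i ξ => a (ξ + H i) := by
  have key : ∀ {a : E → ℂ}, ContDiff ℝ ∞ a → HasCompactSupport a →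
      ∃ C : ℝ, ∀ i, ∀ ξ ∈ O, ‖a (ξ + H i)‖ ≤ C := by
    intro a ha ca
    obtain ⟨C, hC⟩ := ha.continuous.bounded_above_of_compact_support ca
    exact ⟨C, fun i ξ _ => hC _⟩
  induction k with
  | zero => exact fun ha ca => key ha ca
  | succ k ih =>
    intro a ha ca
    refine ⟨key ha ca, ?_⟩
    simp only [fderiv_comp_add_right]
    exact ih (a := fun ξ => fderiv ℝ a ξ e) ((ha.fderiv_right (by simp)).clm_apply contDiff_const)
      (ca.fderiv_apply ℝ e)

/-- A derivative of a difference quotient is the difference quotient of a derivative, and each is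
bounded by a Lipschitz constant. This keeps the phase divided by `‖h‖` under control as `h` tends to
zero. -/
theorem UniformDerivBound.differenceQuotient {E ι : Type*} [NormedAddCommGroup E]
    [NormedSpace ℝ E] (O : Set E) (e : E) (H : ι → E) (k : ℕ) :
    ∀ {g : E → ℂ}, ContDiff ℝ ∞ g → HasCompactSupport g →
      UniformDerivBound O e k fun i ξ => ((‖H i‖⁻¹ : ℝ) : ℂ) * (g (ξ + H i) - g ξ) := by
  have key : ∀ {g : E → ℂ}, ContDiff ℝ ∞ g → HasCompactSupport g →
      ∃ C : ℝ, ∀ i, ∀ ξ ∈ O, ‖((‖H i‖⁻¹ : ℝ) : ℂ) * (g (ξ + H i) - g ξ)‖ ≤ C := by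
    intro g hg cg
    obtain ⟨C, hC⟩ := hg.lipschitzWith_of_hasCompactSupport cg (by simp)
    refine ⟨C, fun i ξ _ => ?_⟩
    have h1 : ‖g (ξ + H i) - g ξ‖ ≤ C * ‖H i‖ := by
      simpa using hC.norm_sub_le (ξ + H i) ξ
    rw [norm_mul, Complex.norm_real, norm_inv, norm_norm]
    rcases eq_or_ne (H i) 0 with h0 | h0
    · simp [h0]
    · rw [inv_mul_le_iff₀ (norm_pos_iff.2 h0), mul_comm]
      exact h1
  induction k with
  | zero => exact fun hg cg => key hg cg
  | succ k ih =>
    intro g hg cg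
    refine ⟨key hg cg, ?_⟩
    convert ih (g := fun ξ => fderiv ℝ g ξ e)
      ((hg.fderiv_right (by simp)).clm_apply contDiff_const) (cg.fderiv_apply ℝ e) using 3 with i ξ
    have h1 : DifferentiableAt ℝ (fun ξ => g (ξ + H i)) ξ :=
      (hg.comp (contDiff_id.add contDiff_const)).differentiable (by simp) ξ
    have h2 : DifferentiableAt ℝ g ξ := hg.differentiable (by simp) ξ
    have h3 := ((h1.hasFDerivAt.fun_sub h2.hasFDerivAt).const_mul ((‖H i‖⁻¹ : ℝ) : ℂ)).fderiv
    rw [h3, fderiv_comp_add_right]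
    simp

variable {d : ℕ}

local notation "E" => EuclideanSpace ℝ (Fin d)

/-- If a function has a nondegenerate Hessian at a point, then the increments of its gradient near
that point are bounded below in one of finitely many coordinate directions. -/
theorem exists_gradient_increment_bound (ψ : E → ℝ) (hψ : ContDiff ℝ ∞ ψ) (ξ₀ : E)
    (hinj : ∀ h : E, (∀ k, fderiv ℝ (fun η => fderiv ℝ ψ η (EuclideanSpace.single k 1)) ξ₀ h = 0) →
      h = 0) :
    ∃ r > 0, ∃ c > 0, ∃ S : Fin d → Set E, (∀ h : E, h ≠ 0 → ∃ k, h ∈ S k) ∧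
      ∀ k, ∀ h ∈ S k, ∀ ξ ∈ Metric.ball ξ₀ r, ξ + h ∈ Metric.ball ξ₀ r →
        c * ‖h‖ ≤ |fderiv ℝ ψ (ξ + h) (EuclideanSpace.single k 1) -
          fderiv ℝ ψ ξ (EuclideanSpace.single k 1)| := by
  set g : Fin d → E → ℝ := fun k η => fderiv ℝ ψ η (EuclideanSpace.single k 1) with hg
  have sg : ∀ k, ContDiff ℝ ∞ (g k) := fun k =>
    (hψ.fderiv_right (by simp)).clm_apply contDiff_const
  set T : E →L[ℝ] (Fin d → ℝ) := ContinuousLinearMap.pi fun k => fderiv ℝ (g k) ξ₀ with hT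
  have hker : LinearMap.ker (T : E →ₗ[ℝ] (Fin d → ℝ)) = ⊥ := by
    refine LinearMap.ker_eq_bot'.2 fun h hh => hinj h fun k => ?_
    exact congrFun hh k
  obtain ⟨K, hK, hT'⟩ := T.toLinearMap.exists_antilipschitzWith hker
  -- The antilipschitz bound in the sup norm selects a coordinate in which the derivative at `ξ₀` is
  -- at least `2 * c * ‖h‖`. Half of this is kept when passing to nearby points.
  set c : ℝ := (K : ℝ)⁻¹ / 4 with hc
  have hK' : (0 : ℝ) < K := hK
  have hc0 : 0 < c := by positivity
  have hS : ∀ h : E, h ≠ 0 → ∃ k, 2 * c * ‖h‖ ≤ |fderiv ℝ (g k) ξ₀ h| := by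
    intro h hh
    by_contra! hlt
    have h1 : ‖T h‖ < 2 * c * ‖h‖ := by
      rw [pi_norm_lt_iff (by have := norm_pos_iff.2 hh; positivity)]
      exact hlt
    have h2 := hT'.le_mul_dist h 0
    simp only [dist_zero_right, map_zero, ContinuousLinearMap.coe_coe] at h2
    have h3 : ‖h‖ < K * (2 * c * ‖h‖) := h2.trans_lt (by gcongr)
    have h4 : K * (2 * c * ‖h‖) = ‖h‖ / 2 := by rw [hc]; field_simp; norm_num
    have := norm_nonneg h
    linarith
  -- Strict differentiability is what allows both endpoints of the increment to vary.
  have hnear : ∀ k, ∃ r > 0, ∀ ξ ∈ Metric.ball ξ₀ r, ∀ η ∈ Metric.ball ξ₀ r,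
      |g k η - g k ξ - fderiv ℝ (g k) ξ₀ (η - ξ)| ≤ c * ‖η - ξ‖ := by
    intro k
    have h1 : HasStrictFDerivAt (g k) (fderiv ℝ (g k) ξ₀) ξ₀ :=
      (sg k).contDiffAt.hasStrictFDerivAt (by simp)
    obtain ⟨r, hr, hr'⟩ := Metric.eventually_nhds_iff_ball.1 (h1.isLittleO.def hc0)
    refine ⟨r, hr, fun ξ hξ η hη => hr' (η, ξ) ?_⟩
    rw [← ball_prod_same]
    exact ⟨hη, hξ⟩
  choose r hr hrk using hnear
  obtain ⟨ρ, hρ, hρr⟩ : ∃ ρ > 0, ∀ k, ρ ≤ r k := by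
    rcases isEmpty_or_nonempty (Fin d) with hd | hd
    · exact ⟨1, one_pos, fun k => (hd.false k).elim⟩
    · obtain ⟨k, hk⟩ := Finite.exists_min r
      exact ⟨r k, hr k, hk⟩
  refine ⟨ρ, hρ, c, hc0, fun k => {h | 2 * c * ‖h‖ ≤ |fderiv ℝ (g k) ξ₀ h|}, hS, ?_⟩
  intro k h hh ξ hξ hξh
  have h1 := hrk k ξ (Metric.ball_subset_ball (hρr k) hξ) _ (Metric.ball_subset_ball (hρr k) hξh)
  rw [add_sub_cancel_left] at h1
  have h2 : 2 * c * ‖h‖ ≤ |fderiv ℝ (g k) ξ₀ h| := hh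
  have h3 := abs_sub_abs_le_abs_sub (fderiv ℝ (g k) ξ₀ h) (g k (ξ + h) - g k ξ)
  rw [abs_sub_comm (fderiv ℝ (g k) ξ₀ h)] at h3
  linarith

/-- The inner integral in the square of an oscillatory integral decays in the increment `h`. -/
theorem exists_autocorrelation_bound (ψ : E → ℝ) (hψ : ContDiff ℝ ∞ ψ) (cψ : HasCompactSupport ψ)
    (ξ₀ : E)
    (hinj : ∀ h : E, (∀ k, fderiv ℝ (fun η => fderiv ℝ ψ η (EuclideanSpace.single k 1)) ξ₀ h = 0) →
      h = 0) (N : ℕ) :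
    ∃ r > 0, ∀ a : E → ℝ, ContDiff ℝ ∞ a → tsupport a ⊆ Metric.closedBall ξ₀ r →
      ∃ C : ℝ, ∀ (t : ℝ) (h : E), (1 + |t| * ‖h‖) ^ N *
        ‖∫ ξ, Complex.exp ((t * (ψ (ξ + h) - ψ ξ) : ℝ) * Complex.I) * (a (ξ + h) * a ξ : ℝ)‖
          ≤ C := by
  obtain ⟨r, hr, c, hc, S, hS, hgr⟩ := exists_gradient_increment_bound ψ hψ ξ₀ hinj
  -- If `a (ξ + h) * a ξ ≠ 0` then `‖h‖ ≤ 2r/5 < r/2`. For such `h`, points of the ball of radius `r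
  -- / 2` stay within the ball of radius `r` after translation, where the gradient bound holds.
  refine ⟨r / 5, by positivity, fun a sa hta => ?_⟩
  have ca : HasCompactSupport a :=
    (isCompact_closedBall ξ₀ (r / 5)).of_isClosed_subset (isClosed_tsupport _) hta
  set J : ℝ → E → ℂ := fun t h =>
    ∫ ξ, Complex.exp ((t * (ψ (ξ + h) - ψ ξ) : ℝ) * Complex.I) * (a (ξ + h) * a ξ : ℝ) with hJ
  have hJ0 : ∃ C : ℝ, ∀ t h, ‖J t h‖ ≤ C := by
    obtain ⟨A, hA⟩ := sa.continuous.bounded_above_of_compact_support ca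
    refine ⟨∫ ξ, A * ‖a ξ‖, fun t h => norm_integral_le_of_norm_le
      ((sa.continuous.norm.integrable_of_hasCompactSupport ca.norm).const_mul _)
      (.of_forall fun ξ => ?_)⟩
    rw [norm_mul, Complex.norm_exp_ofReal_mul_I, one_mul, Complex.norm_real, norm_mul]
    gcongr
    exact hA _
  have hJN : ∀ k, ∃ C : ℝ, ∀ t, ∀ h ∈ S k, h ≠ 0 → ‖h‖ < r / 2 →
      (|t| * ‖h‖) ^ N * ‖J t h‖ ≤ C := by
    intro k
    set e : E := EuclideanSpace.single k 1 with he
    set ι := {h : E // h ∈ S k ∧ h ≠ 0 ∧ ‖h‖ < r / 2}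
    set O := Metric.ball ξ₀ (r / 2) with hO
    set ψc : E → ℂ := fun ξ => (ψ ξ : ℂ) with hψc
    have sψc : ContDiff ℝ ∞ ψc := Complex.ofRealCLM.contDiff.comp hψ
    have cψc : HasCompactSupport ψc := cψ.comp_left Complex.ofReal_zero
    have sac : ContDiff ℝ ∞ (fun ξ => (a ξ : ℂ)) := Complex.ofRealCLM.contDiff.comp sa
    have cac : HasCompactSupport (fun ξ => (a ξ : ℂ)) := ca.comp_left Complex.ofReal_zero
    -- Dividing the phase by `‖h‖` gives a family with gradient bounded above and below uniformly in
    -- `h`; the frequency becomes `t * ‖h‖`.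
    set θ : ι → E → ℝ := fun i ξ => ‖i.1‖⁻¹ * (ψ (ξ + i.1) - ψ ξ) with hθ
    have sθ : ∀ i, ContDiff ℝ ∞ (θ i) := fun i =>
      contDiff_const.mul ((hψ.comp (contDiff_id.add contDiff_const)).sub hψ)
    have dψc : ∀ ξ, fderiv ℝ ψc ξ e = (fderiv ℝ ψ ξ e : ℂ) := fun ξ => by
      have := (Complex.ofRealCLM.hasFDerivAt.comp ξ
        (hψ.differentiable (by simp) ξ).hasFDerivAt).fderiv
      have h2 : fderiv ℝ ψc ξ = _ := this
      rw [h2]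
      rfl
    have dθ : ∀ i ξ, fderiv ℝ (fun η => (θ i η : ℂ)) ξ e =
        ((‖i.1‖⁻¹ : ℝ) : ℂ) * (fderiv ℝ ψc (ξ + i.1) e - fderiv ℝ ψc ξ e) := by
      intro i ξ
      have h1 : DifferentiableAt ℝ (fun ξ => ψc (ξ + i.1)) ξ :=
        (sψc.comp (contDiff_id.add contDiff_const)).differentiable (by simp) ξ
      have h2 : DifferentiableAt ℝ ψc ξ := sψc.differentiable (by simp) ξ
      have h3 := ((h1.hasFDerivAt.fun_sub h2.hasFDerivAt).const_mul ((‖i.1‖⁻¹ : ℝ) : ℂ)).fderiv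
      have h4 : (fun η => (θ i η : ℂ)) =
          fun ξ => ((‖i.1‖⁻¹ : ℝ) : ℂ) * (ψc (ξ + i.1) - ψc ξ) := by
        ext ξ
        simp [hθ, hψc]
      rw [h4, h3, fderiv_comp_add_right]
      simp
    have hw : ∀ i : ι, ∀ ξ ∈ O, c ≤ ‖fderiv ℝ (fun η => (θ i η : ℂ)) ξ e‖ := by
      intro i ξ hξ
      have hpos : 0 < ‖i.1‖ := norm_pos_iff.2 i.2.2.1
      have h1 := hgr k i.1 i.2.1 ξ (Metric.ball_subset_ball (by linarith) hξ) (by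
        rw [hO, Metric.mem_ball, dist_eq_norm] at hξ
        rw [Metric.mem_ball, dist_eq_norm, add_sub_right_comm]
        exact (norm_add_le _ _).trans_lt (by linarith [i.2.2.2]))
      rw [dθ, dψc, dψc, ← Complex.ofReal_sub, ← Complex.ofReal_mul, Complex.norm_real, norm_mul,
        norm_inv, norm_norm, le_inv_mul_iff₀ hpos, mul_comm]
      exact h1
    have hwB : ∀ n, UniformDerivBound O e n fun (i : ι) ξ =>
        fderiv ℝ (fun η => (θ i η : ℂ)) ξ e := by
      intro n
      simp only [dθ]
      exact UniformDerivBound.differenceQuotient O e (fun i : ι => i.1) n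
        (g := fun ξ => fderiv ℝ ψc ξ e) ((sψc.fderiv_right (by simp)).clm_apply contDiff_const)
        (cψc.fderiv_apply ℝ e)
    have stac : ∀ i : ι, ContDiffOn ℝ ∞ (fun ξ => (a (ξ + i.1) : ℂ)) O := fun i =>
      (sac.comp (contDiff_id.add contDiff_const)).contDiffOn
    obtain ⟨C, hC⟩ := exists_nonstationary_bound (μ := volume) Metric.isOpen_ball
      (isCompact_closedBall ξ₀ (r / 5)) (Metric.closedBall_subset_ball (by linarith)) e θ sθ hc hw
      hwB N (fun (i : ι) ξ => (a (ξ + i.1) : ℂ) * (a ξ : ℂ))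
      (fun i => (stac i).mul sac.contDiffOn)
      (fun i => tsupport_mul_subset_right.trans
        ((closure_mono (Function.support_comp_subset Complex.ofReal_zero a)).trans hta))
      (fun n => UniformDerivBound.mul Metric.isOpen_ball stac (fun i => sac.contDiffOn)
        (UniformDerivBound.translate O e (fun i : ι => i.1) n sac cac)
        (by simpa using UniformDerivBound.translate O e (fun i : ι => (0 : E)) n sac cac))
    refine ⟨C, fun t h hk h0 hh => ?_⟩
    have h1 := hC ⟨h, hk, h0, hh⟩ (t * ‖h‖)
    rw [abs_mul, abs_norm] at h1
    convert h1 using 5 with ξ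
    congr 2
    · have : ‖h‖ ≠ 0 := norm_ne_zero_iff.2 h0
      rw [← Complex.ofReal_mul]
      congr 2
      simp only [hθ]
      field_simp
    · simp
  obtain ⟨C₀, hC₀⟩ := hJ0
  choose C hC using hJN
  have hall : ∀ t h, (|t| * ‖h‖) ^ N * ‖J t h‖ ≤ |C₀| + ∑ k, |C k| := by
    intro t h
    have hsum : ∀ k, |C k| ≤ ∑ k, |C k| := fun k =>
      Finset.single_le_sum (f := fun k => |C k|) (fun _ _ => abs_nonneg _) (Finset.mem_univ k)
    have hsum0 : 0 ≤ ∑ k, |C k| := Finset.sum_nonneg fun _ _ => abs_nonneg _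
    rcases eq_or_ne h 0 with rfl | h0
    · have h1 : (|t| * ‖(0 : E)‖) ^ N ≤ 1 := pow_le_one₀ (by simp) (by simp)
      have h2 := mul_le_mul h1 ((hC₀ t 0).trans (le_abs_self _)) (norm_nonneg _) zero_le_one
      linarith
    · rcases lt_or_ge ‖h‖ (r / 2) with hlt | hge
      · obtain ⟨k, hk⟩ := hS h h0
        have := hC k t h hk h0 hlt
        linarith [le_abs_self (C k), hsum k, abs_nonneg C₀]
      · have : J t h = 0 := by
          refine integral_eq_zero_of_ae (.of_forall fun ξ => ?_)
          have : a (ξ + h) * a ξ = 0 := by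
            by_contra hne
            have h1 := hta (subset_tsupport a (left_ne_zero_of_mul hne))
            have h2 := hta (subset_tsupport a (right_ne_zero_of_mul hne))
            have h3 : dist (ξ + h) ξ ≤ r / 5 + r / 5 :=
              (dist_triangle_right _ _ ξ₀).trans (add_le_add h1 h2)
            rw [dist_eq_norm, add_sub_cancel_left] at h3
            linarith
          simp [this]
        rw [this, norm_zero, mul_zero]
        positivity
  refine ⟨2 ^ (N - 1) * (|C₀| + (|C₀| + ∑ k, |C k|)), fun t h => ?_⟩
  calc (1 + |t| * ‖h‖) ^ N * ‖J t h‖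
      ≤ 2 ^ (N - 1) * (1 ^ N + (|t| * ‖h‖) ^ N) * ‖J t h‖ := by
        gcongr
        exact add_pow_le zero_le_one (by positivity) N
    _ = 2 ^ (N - 1) * (‖J t h‖ + (|t| * ‖h‖) ^ N * ‖J t h‖) := by ring
    _ ≤ _ := by
        gcongr
        · exact (hC₀ t h).trans (le_abs_self _)
        · exact hall t h

/-- The square of an oscillatory integral with a linear perturbation of the phase is controlled by
autocorrelation integrals that do not depend on the perturbation. -/
theorem norm_sq_oscillatory_le (ψ : E → ℝ) (hψ : Continuous ψ) (a : E → ℝ) (sa : Continuous a)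
    (ca : HasCompactSupport a) (l : E →L[ℝ] ℝ) (t : ℝ) :
    ‖∫ ξ, Complex.exp ((l ξ + t * ψ ξ : ℝ) * Complex.I) * (a ξ : ℂ)‖ ^ 2 ≤
      ∫ h, ‖∫ ξ, Complex.exp ((t * (ψ (ξ + h) - ψ ξ) : ℝ) * Complex.I) * (a (ξ + h) * a ξ : ℝ)‖ := by
  set F : E → ℂ := fun ξ => Complex.exp ((l ξ + t * ψ ξ : ℝ) * Complex.I) * (a ξ : ℂ) with hF
  have cF : Continuous F := by fun_prop
  have iF : Integrable F := by
    refine cF.integrable_of_hasCompactSupport ?_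
    exact (ca.comp_left Complex.ofReal_zero).mul_left
  have iP : Integrable (fun p : E × E => F (p.1 + p.2) * (starRingEnd ℂ) (F p.1))
      (volume.prod volume) := by
    have h1 : Integrable (fun p : E × E => (starRingEnd ℂ) (F p.1) * F p.2)
      (volume.prod volume) := (Complex.conjCLE.integrable_comp_iff.2 iF).mul_prod iF
    exact ((measurePreserving_prod_add (volume : Measure E)
      volume).integrable_comp_of_integrable h1).congr (.of_forall fun p => mul_comm _ _)
  have key : ((‖∫ ξ, F ξ‖ ^ 2 : ℝ) : ℂ) = ∫ h, ∫ ξ, F (ξ + h) * (starRingEnd ℂ) (F ξ) := by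
    rw [← integral_integral_swap (f := fun ξ h => F (ξ + h) * (starRingEnd ℂ) (F ξ)) iP]
    simp only [integral_mul_const, integral_add_left_eq_self]
    rw [integral_const_mul, integral_conj, Complex.mul_conj]
    simp [Complex.normSq_eq_norm_sq]
  have key2 : ‖∫ ξ, F ξ‖ ^ 2 = ‖∫ h, ∫ ξ, F (ξ + h) * (starRingEnd ℂ) (F ξ)‖ := by
    rw [← key, Complex.norm_real, Real.norm_of_nonneg (by positivity)]
  rw [key2]
  refine (norm_integral_le_integral_norm _).trans (le_of_eq ?_)
  congr 1
  ext h
  -- The linear part contributes `l (ξ + h) - l ξ = l h`, a unimodular constant in the inner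
  -- integral. Hence the final bound is uniform in `l`.
  have : ∀ ξ, F (ξ + h) * (starRingEnd ℂ) (F ξ) = Complex.exp ((l h : ℝ) * Complex.I) *
      (Complex.exp ((t * (ψ (ξ + h) - ψ ξ) : ℝ) * Complex.I) * (a (ξ + h) * a ξ : ℝ)) := by
    intro ξ
    simp only [hF, map_mul, ← Complex.exp_conj, Complex.conj_ofReal, Complex.conj_I, map_add]
    have : ((l h : ℝ) : ℂ) * Complex.I + (t * (ψ (ξ + h) - ψ ξ) : ℝ) * Complex.I =
        ((l ξ + l h + t * ψ (ξ + h) : ℝ) : ℂ) * Complex.I +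
        ((l ξ + t * ψ ξ : ℝ) : ℂ) * -Complex.I := by
      push_cast
      ring
    rw [← mul_assoc (Complex.exp ((l h : ℝ) * Complex.I)), ← Complex.exp_add, this,
      Complex.exp_add, Complex.ofReal_mul (a (ξ + h))]
    ring
  simp only [this]
  rw [integral_const_mul, norm_mul, Complex.norm_exp_ofReal_mul_I, one_mul]

/-- Decay of oscillatory integrals with a nondegenerate phase, uniformly over linear perturbations
of the phase. -/
theorem exists_oscillatory_decay (ψ : E → ℝ) (hψ : ContDiff ℝ ∞ ψ) (cψ : HasCompactSupport ψ)
    (ξ₀ : E)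
    (hinj : ∀ h : E, (∀ k, fderiv ℝ (fun η => fderiv ℝ ψ η (EuclideanSpace.single k 1)) ξ₀ h = 0) →
      h = 0) :
    ∃ r > 0, ∀ a : E → ℝ, ContDiff ℝ ∞ a → tsupport a ⊆ Metric.closedBall ξ₀ r →
      ∃ C : ℝ, ∀ (l : E →L[ℝ] ℝ) (t : ℝ),
        |t| ^ d * ‖∫ ξ, Complex.exp ((l ξ + t * ψ ξ : ℝ) * Complex.I) * (a ξ : ℂ)‖ ^ 2 ≤ C := by
  -- The power `d + 1` is enough for integrability in `h`; rescaling `h` by `|t|` then produces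
  -- `|t|^(-d)`.
  obtain ⟨r, hr, H⟩ := exists_autocorrelation_bound ψ hψ cψ ξ₀ hinj (d + 1)
  refine ⟨r, hr, fun a sa hta => ?_⟩
  obtain ⟨C, hC⟩ := H a sa hta
  have ca : HasCompactSupport a :=
    (isCompact_closedBall ξ₀ r).of_isClosed_subset (isClosed_tsupport _) hta
  have hC0 : 0 ≤ C := le_trans (by positivity) (hC 0 0)
  have hint : Integrable (fun h : E => (1 + ‖h‖) ^ (-((d + 1 : ℕ) : ℝ))) :=
    integrable_one_add_norm (by simp)
  set M : ℝ := ∫ h : E, (1 + ‖h‖) ^ (-((d + 1 : ℕ) : ℝ)) with hM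
  have hM0 : 0 ≤ M := integral_nonneg fun h => by positivity
  have hsq := fun l t => norm_sq_oscillatory_le ψ hψ.continuous a sa.continuous ca l t
  rcases Nat.eq_zero_or_pos d with rfl | hd
  · refine ⟨(∫ ξ, ‖a ξ‖) ^ 2, fun l t => ?_⟩
    rw [pow_zero, one_mul]
    gcongr
    refine (norm_integral_le_integral_norm _).trans (le_of_eq ?_)
    simp [Complex.norm_exp_ofReal_mul_I, -Complex.ofReal_add, -Complex.ofReal_mul]
  refine ⟨C * M, fun l t => ?_⟩
  rcases eq_or_ne t 0 with rfl | ht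
  · rw [abs_zero, zero_pow hd.ne', zero_mul]
    positivity
  have ht' : 0 < |t| := abs_pos.2 ht
  have hscale : ∫ h : E, C * (1 + ‖|t| • h‖) ^ (-((d + 1 : ℕ) : ℝ)) = C * ((|t| ^ d)⁻¹ * M) := by
    rw [integral_const_mul, Measure.integral_comp_smul volume
      (fun h : E => (1 + ‖h‖) ^ (-((d + 1 : ℕ) : ℝ)))]
    simp [hM]
  have hle : ‖∫ ξ, Complex.exp ((l ξ + t * ψ ξ : ℝ) * Complex.I) * (a ξ : ℂ)‖ ^ 2 ≤
      C * ((|t| ^ d)⁻¹ * M) := by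
    rw [← hscale]
    refine (hsq l t).trans (integral_mono_of_nonneg (.of_forall fun h => norm_nonneg _) ?_
      (.of_forall fun h => ?_))
    · exact (hint.comp_smul ht'.ne').const_mul C
    · have hp : 0 < (1 + |t| * ‖h‖) := by positivity
      simp only [norm_smul, Real.norm_eq_abs, abs_abs]
      rw [Real.rpow_neg hp.le, Real.rpow_natCast, ← div_eq_mul_inv,
        le_div_iff₀ (pow_pos hp _), mul_comm]
      exact hC t h
  calc _ ≤ |t| ^ d * (C * ((|t| ^ d)⁻¹ * M)) := by gcongr
    _ = C * M := by field_simp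

end Decay

/-! ### Complex interpolation of bilinear forms on simple functions. -/

section Interpolation

/-- The three lines theorem for a finite sum of exponentials. -/
theorem norm_exponentialSum_le {ι : Type*} (I : Finset ι) (c : ι → ℂ) (α : ι → ℝ) {A B θ : ℝ}
    (hθ₀ : 0 ≤ θ) (hθ₁ : θ ≤ 1)
    (h₀ : ∀ z : ℂ, z.re = 0 → ‖∑ i ∈ I, c i * Complex.exp (α i * z)‖ ≤ A)
    (h₁ : ∀ z : ℂ, z.re = 1 → ‖∑ i ∈ I, c i * Complex.exp (α i * z)‖ ≤ B) :
    ‖∑ i ∈ I, c i * Complex.exp (α i * θ)‖ ≤ A ^ (1 - θ) * B ^ θ := by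
  have hdiff : Differentiable ℂ fun z : ℂ => ∑ i ∈ I, c i * Complex.exp (α i * z) := by
    fun_prop
  have h := Complex.HadamardThreeLines.norm_le_interp_of_mem_verticalClosedStrip₀₁'
    (fun z : ℂ => ∑ i ∈ I, c i * Complex.exp (α i * z)) (z := (θ : ℂ)) (a := A) (b := B)
    (by simpa [Complex.HadamardThreeLines.verticalClosedStrip] using ⟨hθ₀, hθ₁⟩)
    hdiff.diffContOnCl ?_ (fun z hz => h₀ z hz) (fun z hz => h₁ z hz)
  · simpa using h
  · refine ⟨∑ i ∈ I, ‖c i‖ * Real.exp |α i|, ?_⟩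
    rintro _ ⟨z, hz, rfl⟩
    refine norm_sum_le_of_le _ fun i _ => ?_
    rw [norm_mul, Complex.norm_exp]
    gcongr
    have h1 : 0 ≤ z.re ∧ z.re ≤ 1 := hz
    have h2 : ((α i : ℂ) * z).re = α i * z.re := by simp
    rw [h2]
    calc α i * z.re ≤ |α i| * z.re := by gcongr; exacts [h1.1, le_abs_self _]
      _ ≤ |α i| := mul_le_of_le_one_right (abs_nonneg _) h1.2

/-- The analytic family `|a|^{p(1+z)/2} a/|a|` through which simple functions are deformed. -/
noncomputable def powerTwist (p : ℝ) (z a : ℂ) : ℂ :=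
  a / ‖a‖ * Complex.exp (p * (1 + z) / 2 * Real.log ‖a‖)

theorem powerTwist_zero (p : ℝ) (z : ℂ) : powerTwist p z 0 = 0 := by simp [powerTwist]

/-- On `re z = 0` the exponent is `p / 2` and on `re z = 1` it is `p`, so both the squared `L²` norm
and the `L¹` norm of the twisted function reduce to the integral of `‖f‖ ^ p`. -/
theorem norm_powerTwist {p : ℝ} (hp : 0 < p) {z : ℂ} (hz : 0 ≤ z.re) (a : ℂ) :
    ‖powerTwist p z a‖ = ‖a‖ ^ (p * (1 + z.re) / 2) := by
  rcases eq_or_ne a 0 with rfl | ha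
  · rw [powerTwist_zero, norm_zero, Real.zero_rpow]
    positivity
  · have hn : 0 < ‖a‖ := norm_pos_iff.2 ha
    rw [powerTwist, norm_mul, norm_div, Complex.norm_real, norm_norm, div_self hn.ne', one_mul,
      Complex.norm_exp, Real.rpow_def_of_pos hn]
    congr 1
    have : (p * (1 + z) / 2 * Real.log ‖a‖ : ℂ) =
        ((p / 2 * Real.log ‖a‖ : ℝ) : ℂ) * (1 + z) := by
      push_cast
      ring
    rw [this, Complex.re_ofReal_mul]
    simp
    ring

theorem powerTwist_eq_self {p θ : ℝ} (hp : p * (1 + θ) = 2) (a : ℂ) :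
    powerTwist p θ a = a := by
  rcases eq_or_ne a 0 with rfl | ha
  · exact powerTwist_zero _ _
  · have hn : 0 < ‖a‖ := norm_pos_iff.2 ha
    have h1 : ((p : ℂ) * (1 + θ) / 2) = 1 := by
      have : ((p * (1 + θ) : ℝ) : ℂ) = 2 := by rw [hp]; simp
      push_cast at this
      rw [this]
      simp
    rw [powerTwist, h1, one_mul, ← Complex.ofReal_exp, Real.exp_log hn]
    exact div_mul_cancel₀ _ (by exact_mod_cast hn.ne')

variable {X : Type*} [MeasurableSpace X] {μ : Measure X}

theorem measure_simpleFunc_preimage_lt_top {f : SimpleFunc X ℂ} (hf : Integrable f μ) {a : ℂ}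
    (ha : a ≠ 0) : μ (f ⁻¹' {a}) < ⊤ :=
  SimpleFunc.integrable_iff.1 hf a ha

variable [SFinite μ]

/-- Expansion of a bilinear form along the level sets of two simple functions. -/
theorem integral_map_simpleFunc_mul (f g : SimpleFunc X ℂ) (hf : Integrable f μ)
    (hg : Integrable g μ) (F G : ℂ → ℂ) (hF : F 0 = 0) (hG : G 0 = 0) {κ : Type*} (J : Finset κ)
    (k : κ → X × X → ℂ) (hkm : ∀ j, AEStronglyMeasurable (k j) (μ.prod μ))
    (hkb : ∀ j, ∃ C : ℝ, ∀ p, ‖k j p‖ ≤ C) (c : κ → ℂ) :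
    ∫ p, F (f p.1) * G (g p.2) * ∑ j ∈ J, c j * k j p ∂(μ.prod μ) =
      ∑ q ∈ J ×ˢ (f.range.filter (· ≠ 0) ×ˢ g.range.filter (· ≠ 0)),
        c q.1 * (F q.2.1 * G q.2.2) * ∫ p, ((f ⁻¹' {q.2.1}) ×ˢ (g ⁻¹' {q.2.2})).indicator (k q.1) p
          ∂(μ.prod μ) := by
  have expand : ∀ (f : SimpleFunc X ℂ) (F : ℂ → ℂ), F 0 = 0 → ∀ x,
      F (f x) = ∑ a ∈ f.range.filter (· ≠ 0), if f x = a then F a else 0 := by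
    intro f F hF x
    rw [Finset.sum_ite_eq]
    split_ifs with h
    · rfl
    · have : f x = 0 := by simpa using h
      rw [this, hF]
  have hpt : ∀ p : X × X, F (f p.1) * G (g p.2) * ∑ j ∈ J, c j * k j p =
      ∑ q ∈ J ×ˢ (f.range.filter (· ≠ 0) ×ˢ g.range.filter (· ≠ 0)),
        c q.1 * (F q.2.1 * G q.2.2) * ((f ⁻¹' {q.2.1}) ×ˢ (g ⁻¹' {q.2.2})).indicator (k q.1) p := by
    intro p
    rw [Finset.sum_product, Finset.mul_sum]
    refine Finset.sum_congr rfl fun j _ => ?_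
    rw [expand f F hF, expand g G hG, Finset.sum_mul_sum, ← Finset.sum_product', Finset.sum_mul]
    refine Finset.sum_congr rfl fun q _ => ?_
    by_cases h1 : f p.1 = q.1 <;> by_cases h2 : g p.2 = q.2 <;>
      simp [Set.indicator, h1, h2]
    ring
  simp only [hpt]
  rw [integral_finsetSum]
  · simp only [integral_const_mul]
  · intro q hq
    simp only [Finset.mem_product, Finset.mem_filter] at hq
    refine Integrable.const_mul ?_ _
    have hm : MeasurableSet ((f ⁻¹' {q.2.1}) ×ˢ (g ⁻¹' {q.2.2})) :=
      (f.measurableSet_fiber _).prod (g.measurableSet_fiber _)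
    rw [integrable_indicator_iff hm]
    obtain ⟨C, hC⟩ := hkb q.1
    refine Measure.integrableOn_of_bounded (M := C) ?_ (hkm _) (.of_forall hC)
    rw [Measure.prod_prod]
    exact (ENNReal.mul_lt_top (measure_simpleFunc_preimage_lt_top hf hq.2.1.2)
      (measure_simpleFunc_preimage_lt_top hg hq.2.2.2)).ne

/-- Complex interpolation of bilinear forms with weights: an `L² × L²` bound with the weights `u`
and an `L¹ × L¹` bound with the weights `v`, both for arbitrary phases, give an `Lᵖ × Lᵖ` bound
with the weights `u^(1-θ) v^θ`. -/
theorem stein_interpolation {κ : Type*} (J : Finset κ) (k : κ → X × X → ℂ)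
    (hkm : ∀ j, AEStronglyMeasurable (k j) (μ.prod μ)) (hkb : ∀ j, ∃ C : ℝ, ∀ p, ‖k j p‖ ≤ C)
    (u v : κ → ℝ) (hu : ∀ j, 0 < u j) (hv : ∀ j, 0 < v j) {M₀ M₁ : ℝ} (hM₀ : 0 ≤ M₀)
    (hM₁ : 0 ≤ M₁)
    (h₀ : ∀ c : κ → ℂ, (∀ j, ‖c j‖ = u j) → ∀ f g : SimpleFunc X ℂ, Integrable f μ →
      Integrable g μ → ‖∫ p, f p.1 * g p.2 * ∑ j ∈ J, c j * k j p ∂(μ.prod μ)‖ ≤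
        M₀ * (∫ x, ‖f x‖ ^ (2 : ℝ) ∂μ) ^ (1 / 2 : ℝ) * (∫ x, ‖g x‖ ^ (2 : ℝ) ∂μ) ^ (1 / 2 : ℝ))
    (h₁ : ∀ c : κ → ℂ, (∀ j, ‖c j‖ = v j) → ∀ f g : SimpleFunc X ℂ, Integrable f μ →
      Integrable g μ → ‖∫ p, f p.1 * g p.2 * ∑ j ∈ J, c j * k j p ∂(μ.prod μ)‖ ≤
        M₁ * (∫ x, ‖f x‖ ∂μ) * (∫ x, ‖g x‖ ∂μ))
    {θ p : ℝ} (hθ₀ : 0 ≤ θ) (hθ₁ : θ ≤ 1) (hp : p * (1 + θ) = 2) (f g : SimpleFunc X ℂ)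
    (hf : Integrable f μ) (hg : Integrable g μ) :
    ‖∫ q, f q.1 * g q.2 * ∑ j ∈ J, ((u j ^ (1 - θ) * v j ^ θ : ℝ) : ℂ) * k j q ∂(μ.prod μ)‖ ≤
      M₀ ^ (1 - θ) * M₁ ^ θ *
        ((∫ x, ‖f x‖ ^ p ∂μ) ^ (1 / p) * (∫ x, ‖g x‖ ^ p ∂μ) ^ (1 / p)) := by
  have hp0 : 0 < p := by
    by_contra! h
    nlinarith
  set cz : ℂ → κ → ℂ := fun z j => Complex.exp ((1 - z) * Real.log (u j) + z * Real.log (v j))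
    with hcz
  have ncz : ∀ z j, ‖cz z j‖ = u j ^ (1 - z.re) * v j ^ z.re := by
    intro z j
    rw [Complex.norm_exp, Real.rpow_def_of_pos (hu j), Real.rpow_def_of_pos (hv j), ← Real.exp_add]
    simp
    ring
  have integ : ∀ {f : SimpleFunc X ℂ}, Integrable f μ → ∀ z,
      Integrable (f.map (powerTwist p z)) μ := by
    intro f hf z
    rw [SimpleFunc.integrable_iff_finMeasSupp] at hf ⊢
    exact hf.map (powerTwist_zero p z)
  set Φ : ℂ → ℂ := fun z => ∫ q, powerTwist p z (f q.1) * powerTwist p z (g q.2) *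
    ∑ j ∈ J, cz z j * k j q ∂(μ.prod μ) with hΦ
  set I := J ×ˢ (f.range.filter (· ≠ 0) ×ˢ g.range.filter (· ≠ 0)) with hI
  set α : κ × (ℂ × ℂ) → ℝ := fun q => Real.log (v q.1) - Real.log (u q.1) +
    p / 2 * Real.log ‖q.2.1‖ + p / 2 * Real.log ‖q.2.2‖ with hα
  set C : κ × (ℂ × ℂ) → ℂ := fun q => Complex.exp (Real.log (u q.1) + p / 2 * Real.log ‖q.2.1‖ +
    p / 2 * Real.log ‖q.2.2‖) * (q.2.1 / ‖q.2.1‖) * (q.2.2 / ‖q.2.2‖) *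
    ∫ p, ((f ⁻¹' {q.2.1}) ×ˢ (g ⁻¹' {q.2.2})).indicator (k q.1) p ∂(μ.prod μ) with hC
  -- Simple functions and a finite `J` make `Φ` a finite exponential sum, so analyticity and
  -- boundedness on the strip are immediate.
  have hΦsum : ∀ z, Φ z = ∑ q ∈ I, C q * Complex.exp (α q * z) := by
    intro z
    rw [hΦ]
    simp only
    rw [integral_map_simpleFunc_mul f g hf hg _ _ (powerTwist_zero p z) (powerTwist_zero p z) J k
      hkm hkb]
    refine Finset.sum_congr rfl fun q _ => ?_
    have : cz z q.1 * (powerTwist p z q.2.1 * powerTwist p z q.2.2) =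
        Complex.exp (Real.log (u q.1) + p / 2 * Real.log ‖q.2.1‖ + p / 2 * Real.log ‖q.2.2‖) *
        Complex.exp (α q * z) * (q.2.1 / ‖q.2.1‖) * (q.2.2 / ‖q.2.2‖) := by
      rw [← Complex.exp_add]
      simp only [hcz, powerTwist]
      rw [show Complex.exp ((1 - z) * Real.log (u q.1) + z * Real.log (v q.1)) *
        (q.2.1 / ‖q.2.1‖ * Complex.exp (p * (1 + z) / 2 * Real.log ‖q.2.1‖) *
        (q.2.2 / ‖q.2.2‖ * Complex.exp (p * (1 + z) / 2 * Real.log ‖q.2.2‖))) =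
        Complex.exp ((1 - z) * Real.log (u q.1) + z * Real.log (v q.1)) *
        Complex.exp (p * (1 + z) / 2 * Real.log ‖q.2.1‖) *
        Complex.exp (p * (1 + z) / 2 * Real.log ‖q.2.2‖) * (q.2.1 / ‖q.2.1‖) *
        (q.2.2 / ‖q.2.2‖) by ring, ← Complex.exp_add, ← Complex.exp_add]
      congr 3
      simp only [hα]
      push_cast
      ring
    rw [this, hC]
    ring
  set A := ∫ x, ‖f x‖ ^ p ∂μ with hA
  set B := ∫ x, ‖g x‖ ^ p ∂μ with hB
  have hA0 : 0 ≤ A := integral_nonneg fun x => by positivity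
  have hB0 : 0 ≤ B := integral_nonneg fun x => by positivity
  have n0 : ∀ (f : SimpleFunc X ℂ) (z : ℂ), z.re = 0 →
      ∫ x, ‖f.map (powerTwist p z) x‖ ^ (2 : ℝ) ∂μ = ∫ x, ‖f x‖ ^ p ∂μ := by
    intro f z hz
    refine integral_congr_ae (.of_forall fun x => ?_)
    simp only [SimpleFunc.map_apply]
    rw [norm_powerTwist hp0 hz.ge, ← Real.rpow_mul (norm_nonneg _), hz]
    congr 1
    ring
  have n1 : ∀ (f : SimpleFunc X ℂ) (z : ℂ), z.re = 1 →
      ∫ x, ‖f.map (powerTwist p z) x‖ ∂μ = ∫ x, ‖f x‖ ^ p ∂μ := by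
    intro f z hz
    refine integral_congr_ae (.of_forall fun x => ?_)
    simp only [SimpleFunc.map_apply]
    rw [norm_powerTwist hp0 (by rw [hz]; exact zero_le_one), hz]
    congr 1
    ring
  have b0 : ∀ z : ℂ, z.re = 0 → ‖Φ z‖ ≤ M₀ * A ^ (1 / 2 : ℝ) * B ^ (1 / 2 : ℝ) := by
    intro z hz
    have := h₀ (cz z) (fun j => by rw [ncz, hz]; simp) (f.map (powerTwist p z))
      (g.map (powerTwist p z)) (integ hf z) (integ hg z)
    rw [n0 f z hz, n0 g z hz] at this
    exact this
  have b1 : ∀ z : ℂ, z.re = 1 → ‖Φ z‖ ≤ M₁ * A * B := by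
    intro z hz
    have := h₁ (cz z) (fun j => by rw [ncz, hz]; simp) (f.map (powerTwist p z))
      (g.map (powerTwist p z)) (integ hf z) (integ hg z)
    rw [n1 f z hz, n1 g z hz] at this
    exact this
  simp only [hΦsum] at b0 b1
  have key := norm_exponentialSum_le I C α hθ₀ hθ₁ b0 b1
  rw [← hΦsum] at key
  have hΦθ : Φ θ = ∫ q, f q.1 * g q.2 * ∑ j ∈ J, ((u j ^ (1 - θ) * v j ^ θ : ℝ) : ℂ) * k j q
      ∂(μ.prod μ) := by
    simp only [hΦ, powerTwist_eq_self hp]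
    have : ∀ j, cz θ j = ((u j ^ (1 - θ) * v j ^ θ : ℝ) : ℂ) := by
      intro j
      rw [Real.rpow_def_of_pos (hu j), Real.rpow_def_of_pos (hv j), ← Real.exp_add]
      simp only [hcz]
      push_cast
      congr 1
      ring
    simp only [this]
  rw [← hΦθ]
  refine key.trans (le_of_eq ?_)
  -- This is `(1 - θ)/2 + θ = (1 + θ)/2 = 1/p`.
  have hpow : ∀ {A : ℝ}, 0 ≤ A → (A ^ (1 / 2 : ℝ)) ^ (1 - θ) * A ^ θ = A ^ (1 / p) := by
    intro A hA
    rw [← Real.rpow_mul hA, ← Real.rpow_add_of_nonneg hA (by linarith) hθ₀]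
    congr 1
    rw [eq_div_iff hp0.ne']
    linarith
  rw [← hpow hA0, ← hpow hB0, Real.mul_rpow (by positivity) (by positivity),
    Real.mul_rpow (by positivity) (by positivity), Real.mul_rpow (by positivity) (by positivity),
    Real.mul_rpow (by positivity) (by positivity)]
  ring

end Interpolation

/-! ### Plancherel and the two endpoint bounds for translation-invariant forms. -/

section Multiplier

open scoped RealInnerProductSpace

variable {V : Type*} [NormedAddCommGroup V] [InnerProductSpace ℝ V] [FiniteDimensional ℝ V]
  [MeasurableSpace V] [BorelSpace V]

theorem continuous_fourier_of_integrable {f : V → ℂ} (hf : Integrable f) : Continuous (𝓕 f) :=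
  VectorFourier.fourierIntegral_continuous Real.continuous_fourierChar continuous_inner hf

/-- The `L²` Fourier transform of an integrable function is given by the Fourier integral. -/
theorem fourier_toLp_ae_eq {f : V → ℂ} (hf₁ : Integrable f) (hf₂ : MemLp f 2) :
    (𝓕 (hf₂.toLp f) : Lp (α := V) ℂ 2) =ᵐ[volume] 𝓕 f := by
  set F : Lp (α := V) ℂ 2 := hf₂.toLp f with hF
  -- Both sides are tested against smooth compactly supported functions: the left side through the
  -- distributional Fourier transform, the right side by moving the Fourier integral onto the test
  -- function.
  refine ae_eq_of_integral_contDiff_smul_eq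
    ((Lp.memLp (𝓕 F)).locallyIntegrable (by norm_num))
    (continuous_fourier_of_integrable hf₁).locallyIntegrable fun g hg cg => ?_
  set φ : 𝓢(V, ℂ) := (cg.comp_left (g := fun x : ℝ => (x : ℂ)) Complex.ofReal_zero).toSchwartzMap
    (Complex.ofRealCLM.contDiff.comp hg) with hφ
  have hφg : ∀ x, φ x = (g x : ℂ) := fun x => rfl
  have h1 := congrArg (fun T : 𝓢'(V, ℂ) => T φ) (Lp.fourier_toTemperedDistribution_eq F)
  simp only [TemperedDistribution.fourier_apply, Lp.toTemperedDistribution_apply] at h1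
  have h2 : ∫ x, (𝓕 φ : 𝓢(V, ℂ)) x • F x = ∫ x, φ x • 𝓕 f x := by
    have h3 := VectorFourier.integral_fourierIntegral_smul_eq_flip (L := innerₗ V) (μ := volume)
      (ν := volume) (f := φ) (g := f) Real.continuous_fourierChar continuous_inner φ.integrable hf₁
    rw [flip_innerₗ] at h3
    refine Eq.trans (integral_congr_ae ?_) h3
    filter_upwards [hf₂.coeFn_toLp] with x hx
    rw [hF, hx]
    rfl
  rw [h2] at h1
  simp only [hφg, smul_eq_mul] at h1
  simp only [Complex.real_smul]
  exact h1.symm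

/-- **Plancherel's theorem** for functions that are integrable and square-integrable. -/
theorem eLpNorm_fourier_eq {f : V → ℂ} (hf₁ : Integrable f) (hf₂ : MemLp f 2) :
    eLpNorm (𝓕 f) 2 volume = eLpNorm f 2 volume := by
  have h := Lp.norm_fourier_eq (hf₂.toLp f)
  rw [Lp.norm_def, Lp.norm_def, ENNReal.toReal_eq_toReal_iff' (Lp.eLpNorm_ne_top _)
    (Lp.eLpNorm_ne_top _)] at h
  rwa [eLpNorm_congr_ae (fourier_toLp_ae_eq hf₁ hf₂), eLpNorm_congr_ae hf₂.coeFn_toLp] at h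

theorem eLpNorm_fourierInv_eq {f : V → ℂ} (hf₁ : Integrable f) (hf₂ : MemLp f 2) :
    eLpNorm (𝓕⁻ f) 2 volume = eLpNorm f 2 volume := by
  rw [← eLpNorm_fourier_eq hf₁ hf₂]
  have : 𝓕⁻ f = 𝓕 f ∘ fun x => -x := by
    ext x
    exact Real.fourierInv_eq_fourier_neg f x
  rw [this, eLpNorm_comp_measurePreserving
    (continuous_fourier_of_integrable hf₁).aestronglyMeasurable
    (Measure.measurePreserving_neg volume)]

/-- A translation-invariant bilinear form whose kernel is an integral of characters, expressed on
the Fourier side. -/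
theorem integral_kernel_eq {W : Type*} [MeasurableSpace W] {ν : Measure W} [SFinite ν] {Γ : W → V}
    (hΓ : AEMeasurable Γ ν) {m : W → ℂ} (hm : Integrable m ν) {f g : V → ℂ} (hf : Integrable f)
    (hg : Integrable g) :
    ∫ p : V × V, f p.1 * g p.2 * ∫ w, Real.fourierChar ⟪Γ w, p.2 - p.1⟫ • m w ∂ν =
      ∫ w, m w * (𝓕 f (Γ w) * 𝓕⁻ g (Γ w)) ∂ν := by
  -- Characters have modulus one, so Fubini needs only integrability of `f`, `g` and `m`. The
  -- identity is used with `Γ = id` for multipliers and with `Γ = graphPoint ψ` for the surface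
  -- density.
  have hint : Integrable (fun q : (V × V) × W => f q.1.1 * g q.1.2 *
      (Real.fourierChar ⟪Γ q.2, q.1.2 - q.1.1⟫ • m q.2)) ((volume : Measure (V × V)).prod ν) := by
    have h1 : Integrable (fun q : (V × V) × W => (f q.1.1 * g q.1.2) * m q.2)
      ((volume : Measure (V × V)).prod ν) := (hf.mul_prod hg).mul_prod hm
    have h2 : AEStronglyMeasurable (fun q : (V × V) × W =>
        ((Real.fourierChar ⟪Γ q.2, q.1.2 - q.1.1⟫ : Circle) : ℂ)) ((volume : Measure (V × V)).prod ν) := by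
      have h3 : AEMeasurable (fun q : (V × V) × W => ⟪Γ q.2, q.1.2 - q.1.1⟫)
          ((volume : Measure (V × V)).prod ν) := by
        refine AEMeasurable.inner (hΓ.comp_quasiMeasurePreserving
          Measure.quasiMeasurePreserving_snd) ?_
        exact ((measurable_snd.comp measurable_fst).sub
          (measurable_fst.comp measurable_fst)).aemeasurable
      have h4 : Continuous fun x : ℝ => ((Real.fourierChar x : Circle) : ℂ) :=
        continuous_induced_dom.comp Real.continuous_fourierChar
      exact (h4.measurable.comp_aemeasurable h3).aestronglyMeasurable
    have h5 := h1.bdd_mul (c := 1) h2 (.of_forall fun q => (Circle.norm_coe _).le)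
    refine h5.congr (.of_forall fun q => ?_)
    simp only [Circle.smul_def, smul_eq_mul]
    ring
  calc ∫ p : V × V, f p.1 * g p.2 * ∫ w, Real.fourierChar ⟪Γ w, p.2 - p.1⟫ • m w ∂ν
      = ∫ p : V × V, ∫ w, f p.1 * g p.2 * (Real.fourierChar ⟪Γ w, p.2 - p.1⟫ • m w) ∂ν := by
        simp only [integral_const_mul]
    _ = ∫ w, (∫ p : V × V, f p.1 * g p.2 * (Real.fourierChar ⟪Γ w, p.2 - p.1⟫ • m w)) ∂ν :=
        integral_integral_swap hint
    _ = _ := by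
        refine integral_congr_ae (.of_forall fun w => ?_)
        simp only
        have : ∀ p : V × V, f p.1 * g p.2 * (Real.fourierChar ⟪Γ w, p.2 - p.1⟫ • m w) =
            m w * ((Real.fourierChar (-⟪p.1, Γ w⟫) • f p.1) *
              (Real.fourierChar ⟪p.2, Γ w⟫ • g p.2)) := by
          intro p
          rw [inner_sub_right, real_inner_comm, real_inner_comm p.1, sub_eq_neg_add,
            AddChar.map_add_eq_mul]
          simp only [Circle.smul_def, smul_eq_mul, Circle.coe_mul]
          ring
        simp only [this]
        rw [integral_const_mul, Measure.volume_eq_prod,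
          integral_prod_mul (fun x => Real.fourierChar (-⟪x, Γ w⟫) • f x)
            (fun x => Real.fourierChar ⟪x, Γ w⟫ • g x), Real.fourier_eq, Real.fourierInv_eq]

theorem toReal_eLpNorm_two {f : V → ℂ} (hf : MemLp f 2) :
    (eLpNorm f 2 volume).toReal = (∫ x, ‖f x‖ ^ (2 : ℝ)) ^ (1 / 2 : ℝ) := by
  rw [hf.eLpNorm_eq_integral_rpow_norm (by norm_num) (by norm_num), ENNReal.toReal_ofReal]
  · norm_num
  · positivity

/-- The `L² × L²` bound for a bilinear form given by a bounded multiplier. -/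
theorem norm_integral_multiplier_le {m : V → ℂ} (hm : Integrable m) {M : ℝ} (hM : ∀ ζ, ‖m ζ‖ ≤ M)
    {f g : V → ℂ} (hf₁ : Integrable f) (hf₂ : MemLp f 2) (hg₁ : Integrable g) (hg₂ : MemLp g 2) :
    ‖∫ p : V × V, f p.1 * g p.2 * 𝓕⁻ m (p.2 - p.1)‖ ≤
      M * (∫ x, ‖f x‖ ^ (2 : ℝ)) ^ (1 / 2 : ℝ) * (∫ x, ‖g x‖ ^ (2 : ℝ)) ^ (1 / 2 : ℝ) := by
  have hM0 : 0 ≤ M := (norm_nonneg _).trans (hM 0)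
  have hF : MemLp (𝓕 f) 2 := ⟨(continuous_fourier_of_integrable hf₁).aestronglyMeasurable, by
    rw [eLpNorm_fourier_eq hf₁ hf₂]; exact hf₂.2⟩
  have hcG : Continuous (𝓕⁻ g) := by
    have : 𝓕⁻ g = 𝓕 g ∘ fun x => -x := by
      ext x
      exact Real.fourierInv_eq_fourier_neg g x
    rw [this]
    exact (continuous_fourier_of_integrable hg₁).comp continuous_neg
  have hG : MemLp (𝓕⁻ g) 2 := ⟨hcG.aestronglyMeasurable, by
    rw [eLpNorm_fourierInv_eq hg₁ hg₂]; exact hg₂.2⟩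
  have h1 := integral_kernel_eq (ν := (volume : Measure V)) (Γ := id) aemeasurable_id hm hf₁ hg₁
  simp only [id, ← Real.fourierInv_eq] at h1
  rw [h1, ← toReal_eLpNorm_two hf₂, ← toReal_eLpNorm_two hg₂, ← eLpNorm_fourier_eq hf₁ hf₂,
    ← eLpNorm_fourierInv_eq hg₁ hg₂, toReal_eLpNorm_two hF, toReal_eLpNorm_two hG]
  have hconj : (2 : ℝ).HolderConjugate 2 := Real.HolderConjugate.two_two
  have hFG : Integrable (fun ζ => ‖𝓕 f ζ‖ * ‖𝓕⁻ g ζ‖) := hF.norm.integrable_mul hG.norm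
  calc ‖∫ ζ, m ζ * (𝓕 f ζ * 𝓕⁻ g ζ)‖ ≤ ∫ ζ, M * (‖𝓕 f ζ‖ * ‖𝓕⁻ g ζ‖) := by
        refine norm_integral_le_of_norm_le (hFG.const_mul M) (.of_forall fun ζ => ?_)
        rw [norm_mul, norm_mul]
        gcongr
        exact hM ζ
    _ = M * ∫ ζ, ‖𝓕 f ζ‖ * ‖𝓕⁻ g ζ‖ := integral_const_mul _ _
    _ ≤ M * ((∫ x, ‖𝓕 f x‖ ^ (2 : ℝ)) ^ (1 / 2 : ℝ) *
          (∫ x, ‖𝓕⁻ g x‖ ^ (2 : ℝ)) ^ (1 / 2 : ℝ)) := by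
        gcongr
        exact integral_mul_norm_le_Lp_mul_Lq hconj (by simpa using hF) (by simpa using hG)
    _ = _ := by ring

/-- The `L¹ × L¹` bound for a bilinear form given by a bounded kernel. -/
theorem norm_integral_kernel_le {k : V → ℂ} {M : ℝ} (hM : ∀ y, ‖k y‖ ≤ M)
    {f g : V → ℂ} (hf : Integrable f) (hg : Integrable g) :
    ‖∫ p : V × V, f p.1 * g p.2 * k (p.2 - p.1)‖ ≤ M * (∫ x, ‖f x‖) * ∫ x, ‖g x‖ := by
  calc ‖∫ p : V × V, f p.1 * g p.2 * k (p.2 - p.1)‖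
      ≤ ∫ p : V × V, M * (‖f p.1‖ * ‖g p.2‖) := by
        refine norm_integral_le_of_norm_le ((hf.norm.mul_prod hg.norm).const_mul M)
          (.of_forall fun p => ?_)
        rw [norm_mul, norm_mul, mul_comm M]
        gcongr
        exact hM _
    _ = _ := by
        rw [integral_const_mul, Measure.volume_eq_prod,
          integral_prod_mul (fun x => ‖f x‖) (fun x => ‖g x‖), mul_assoc]

end Multiplier

/-! ### The surface kernel and its vertical smearing. -/

section Surface

open scoped RealInnerProductSpace

variable {d : ℕ}

/-- The identification of `ℝ^d × ℝ` with `ℝ^(d+1)`, composed with the shear `(ξ, σ) ↦ (ξ, σ + ψ ξ)`. -/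
noncomputable def shearEquiv (ψ : EuclideanSpace ℝ (Fin d) → ℝ) (hψ : Measurable ψ) :
    EuclideanSpace ℝ (Fin d) × ℝ ≃ᵐ EuclideanSpace ℝ (Fin (d + 1)) :=
  (({ toFun := fun p => (p.1, p.2 + ψ p.1)
      invFun := fun p => (p.1, p.2 - ψ p.1)
      left_inv := fun p => by simp
      right_inv := fun p => by simp
      measurable_toFun := measurable_fst.prodMk (measurable_snd.add (hψ.comp measurable_fst))
      measurable_invFun := measurable_fst.prodMk (measurable_snd.sub (hψ.comp measurable_fst)) } :
        EuclideanSpace ℝ (Fin d) × ℝ ≃ᵐ EuclideanSpace ℝ (Fin d) × ℝ).trans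
    ((MeasurableEquiv.toLp 2 (Fin d → ℝ)).symm.prodCongr (MeasurableEquiv.refl ℝ))).trans
  (MeasurableEquiv.prodComm.trans
    ((MeasurableEquiv.piFinSuccAbove (fun _ => ℝ) (Fin.last d)).symm.trans
      (MeasurableEquiv.toLp 2 (Fin (d + 1) → ℝ))))

theorem measurePreserving_shearEquiv (ψ : EuclideanSpace ℝ (Fin d) → ℝ) (hψ : Measurable ψ) :
    MeasurePreserving (shearEquiv ψ hψ) := by
  have h1 : MeasurePreserving (fun p : EuclideanSpace ℝ (Fin d) × ℝ => (p.1, p.2 + ψ p.1)) :=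
    (MeasurePreserving.id volume).skew_product (g := fun ξ σ => σ + ψ ξ)
      (measurable_snd.add (hψ.comp measurable_fst))
      (.of_forall fun ξ => (measurePreserving_add_right volume (ψ ξ)).map_eq)
  have h2 : MeasurePreserving (Prod.map (MeasurableEquiv.toLp 2 (Fin d → ℝ)).symm
      (id : ℝ → ℝ)) :=
    (EuclideanSpace.volume_preserving_symm_measurableEquiv_toLp (Fin d)).prod
      (MeasurePreserving.id volume)
  have h3 : MeasurePreserving (Prod.swap : (Fin d → ℝ) × ℝ → ℝ × (Fin d → ℝ)) :=
    Measure.measurePreserving_swap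
  have h4 := (volume_preserving_piFinSuccAbove (fun _ : Fin (d + 1) => ℝ) (Fin.last d)).symm
  have h5 := (EuclideanSpace.volume_preserving_symm_measurableEquiv_toLp (Fin (d + 1))).symm
  exact h5.comp (h4.comp (h3.comp (h2.comp h1)))

theorem shearEquiv_apply (ψ : EuclideanSpace ℝ (Fin d) → ℝ) (hψ : Measurable ψ)
    (p : EuclideanSpace ℝ (Fin d) × ℝ) :
    shearEquiv ψ hψ p =
      WithLp.toLp 2 (Fin.snoc (α := fun _ => ℝ) (fun j => p.1 j) (p.2 + ψ p.1)) := by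
  have : shearEquiv ψ hψ p =
      WithLp.toLp 2 ((Fin.last d).insertNth (α := fun _ => ℝ) (p.2 + ψ p.1) (fun j => p.1 j)) := rfl
  rw [this, Fin.insertNth_last']

theorem inner_graphPoint (ψ : EuclideanSpace ℝ (Fin d) → ℝ) (ξ : EuclideanSpace ℝ (Fin d))
    (y : EuclideanSpace ℝ (Fin (d + 1))) :
    ⟪graphPoint ψ ξ, y⟫ = ⟪ξ, baseProj y⟫ + y (Fin.last d) * ψ ξ := by
  simp [PiLp.inner_apply, Fin.sum_univ_castSucc, graphPoint, baseProj]

theorem shearEquiv_eq_graphPoint_add (ψ : EuclideanSpace ℝ (Fin d) → ℝ) (hψ : Measurable ψ)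
    (p : EuclideanSpace ℝ (Fin d) × ℝ) :
    shearEquiv ψ hψ p = graphPoint (fun ξ => p.2 + ψ ξ) p.1 := shearEquiv_apply ψ hψ p

theorem baseProj_graphPoint (ψ : EuclideanSpace ℝ (Fin d) → ℝ) (ξ : EuclideanSpace ℝ (Fin d)) :
    baseProj (graphPoint ψ ξ) = ξ := by
  ext j
  simp [baseProj, graphPoint]

theorem graphPoint_last (ψ : EuclideanSpace ℝ (Fin d) → ℝ) (ξ : EuclideanSpace ℝ (Fin d)) :
    graphPoint ψ ξ (Fin.last d) = ψ ξ := by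
  simp [graphPoint]

theorem continuous_graphPoint {ψ : EuclideanSpace ℝ (Fin d) → ℝ} (hψ : Continuous ψ) :
    Continuous (graphPoint ψ) := by
  refine (PiLp.continuous_toLp 2 _).comp (continuous_pi fun j => ?_)
  refine Fin.lastCases ?_ (fun i => ?_) j
  · simpa using hψ
  · simp only [Fin.snoc_castSucc]
    fun_prop

/-- The Fourier transform of the measure `a(ξ) dξ` carried by the graph of `ψ`. -/
noncomputable def surfaceKernel (a ψ : EuclideanSpace ℝ (Fin d) → ℝ)
    (y : EuclideanSpace ℝ (Fin (d + 1))) : ℂ :=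
  ∫ ξ, Real.fourierChar ⟪graphPoint ψ ξ, y⟫ • (a ξ : ℂ)

/-- The measure `a(ξ) dξ` on the graph of `ψ`, smeared out in the vertical direction by the
Fourier transform of `φ`. -/
noncomputable def smearedDensity (a ψ : EuclideanSpace ℝ (Fin d) → ℝ) (φ : 𝓢(ℝ, ℂ))
    (ζ : EuclideanSpace ℝ (Fin (d + 1))) : ℂ :=
  (a (baseProj ζ) : ℂ) * 𝓕 φ (ζ (Fin.last d) - ψ (baseProj ζ))

variable {a ψ : EuclideanSpace ℝ (Fin d) → ℝ}

theorem smearedDensity_shearEquiv (hψ : Measurable ψ) (φ : 𝓢(ℝ, ℂ))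
    (p : EuclideanSpace ℝ (Fin d) × ℝ) :
    smearedDensity a ψ φ (shearEquiv ψ hψ p) = (a p.1 : ℂ) * 𝓕 φ p.2 := by
  rw [shearEquiv_eq_graphPoint_add, smearedDensity, baseProj_graphPoint, graphPoint_last,
    add_sub_cancel_right]

theorem integrable_smearedDensity (hψ : Measurable ψ) (ha : Integrable a) (φ : 𝓢(ℝ, ℂ)) :
    Integrable (smearedDensity a ψ φ) := by
  rw [← (measurePreserving_shearEquiv ψ hψ).integrable_comp_emb
    (shearEquiv ψ hψ).measurableEmbedding]
  simp only [Function.comp_def, smearedDensity_shearEquiv]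
  exact ha.ofReal.mul_prod (𝓕 φ).integrable

/-- In sheared coordinates both the density and the character split into a base factor and a
vertical factor, and the vertical integral is Fourier inversion for `φ`. Thus cutting the kernel off
in its last variable corresponds to a bounded multiplier. -/
theorem fourierInv_smearedDensity (hψ : Measurable ψ) (φ : 𝓢(ℝ, ℂ))
    (y : EuclideanSpace ℝ (Fin (d + 1))) :
    𝓕⁻ (smearedDensity a ψ φ) y = surfaceKernel a ψ y * φ (y (Fin.last d)) := by
  rw [Real.fourierInv_eq, ← (measurePreserving_shearEquiv ψ hψ).integral_comp
    (shearEquiv ψ hψ).measurableEmbedding]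
  have h1 : ∀ p : EuclideanSpace ℝ (Fin d) × ℝ,
      Real.fourierChar ⟪shearEquiv ψ hψ p, y⟫ • smearedDensity a ψ φ (shearEquiv ψ hψ p) =
        (Real.fourierChar ⟪graphPoint ψ p.1, y⟫ • (a p.1 : ℂ)) *
          (Real.fourierChar ⟪p.2, y (Fin.last d)⟫ • 𝓕 φ p.2) := by
    intro p
    rw [smearedDensity_shearEquiv, shearEquiv_eq_graphPoint_add, inner_graphPoint,
      inner_graphPoint]
    have : ⟪p.1, baseProj y⟫ + y (Fin.last d) * (p.2 + ψ p.1) =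
        (⟪p.1, baseProj y⟫ + y (Fin.last d) * ψ p.1) + ⟪p.2, y (Fin.last d)⟫ := by
      simp
      ring
    rw [this, AddChar.map_add_eq_mul]
    simp only [Circle.smul_def, smul_eq_mul, Circle.coe_mul]
    ring
  simp only [h1]
  rw [Measure.volume_eq_prod, integral_prod_mul
    (fun ξ => Real.fourierChar ⟪graphPoint ψ ξ, y⟫ • (a ξ : ℂ))
    (fun σ => Real.fourierChar ⟪σ, y (Fin.last d)⟫ • 𝓕 φ σ), ← Real.fourierInv_eq, ← surfaceKernel]
  congr 1
  have h2 := φ.continuous.fourierInv_fourier_eq φ.integrable (𝓕 φ).integrable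
  exact congrFun h2 _

theorem norm_surfaceKernel_le (y : EuclideanSpace ℝ (Fin (d + 1))) :
    ‖surfaceKernel a ψ y‖ ≤ ∫ ξ, |a ξ| := by
  refine (norm_integral_le_integral_norm _).trans (le_of_eq ?_)
  simp [Circle.norm_smul]

theorem continuous_surfaceKernel (hψ : Continuous ψ) (ha : Integrable a) :
    Continuous (surfaceKernel a ψ) := by
  refine continuous_of_dominated (F := fun y ξ => Real.fourierChar ⟪graphPoint ψ ξ, y⟫ • (a ξ : ℂ))
    (bound := fun ξ => |a ξ|) (fun y => ?_)
    (fun y => .of_forall fun ξ => ?_) ha.abs (.of_forall fun ξ => ?_)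
  · refine AEStronglyMeasurable.smul ?_ ha.ofReal.aestronglyMeasurable
    exact (continuous_induced_dom.comp (Real.continuous_fourierChar.comp
      ((continuous_graphPoint hψ).inner continuous_const))).aestronglyMeasurable
  · simp [Circle.norm_smul]
  · exact (Real.continuous_fourierChar.comp (continuous_const.inner continuous_id)).smul
      continuous_const

end Surface

/-! ### A dyadic resolution of unity with cancellation. -/

section LittlewoodPaley

/-- The terms grow geometrically until `2 ^ j * s` reaches one and decay geometrically afterwards,
so the sum is bounded independently of the scale `s`. -/
theorem sum_min_two_pow_le {s : ℝ} (hs : 0 ≤ s) (J : ℕ) :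
    ∑ j ∈ Finset.range J, min (2 ^ j * s) (2 ^ j * s)⁻¹ ≤ 4 := by
  have large : ∀ (J : ℕ) (s : ℝ), 1 ≤ s →
      ∑ j ∈ Finset.range J, min (2 ^ j * s) (2 ^ j * s)⁻¹ ≤ 2 := by
    intro J s hs
    calc ∑ j ∈ Finset.range J, min (2 ^ j * s) (2 ^ j * s)⁻¹
        ≤ ∑ j ∈ Finset.range J, (1 / 2 : ℝ) ^ j := by
          refine Finset.sum_le_sum fun j _ => (min_le_right _ _).trans ?_
          rw [one_div, inv_pow]
          gcongr
          exact le_mul_of_one_le_right (by positivity) hs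
      _ ≤ 2 := sum_geometric_two_le J
  -- The sharper bound `4 - s` makes the induction close: removing the first term costs at most `s`
  -- and doubles the parameter, and `s + (4 - 2 * s) = 4 - s`.
  have small : ∀ (J : ℕ) (s : ℝ), 0 ≤ s → s ≤ 1 →
      ∑ j ∈ Finset.range J, min (2 ^ j * s) (2 ^ j * s)⁻¹ ≤ 4 - s := by
    intro J
    induction J with
    | zero => intro s _ h1; simp; linarith
    | succ J ih =>
      intro s h0 h1
      rw [Finset.sum_range_succ']
      have hshift : ∑ j ∈ Finset.range J, min (2 ^ (j + 1) * s) (2 ^ (j + 1) * s)⁻¹ =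
          ∑ j ∈ Finset.range J, min (2 ^ j * (2 * s)) (2 ^ j * (2 * s))⁻¹ := by
        refine Finset.sum_congr rfl fun j _ => ?_
        rw [pow_succ, mul_assoc]
      rw [hshift, pow_zero, one_mul]
      have h2 : min s s⁻¹ ≤ s := min_le_left _ _
      rcases le_or_gt (2 * s) 1 with h | h
      · linarith [ih (2 * s) (by linarith) h]
      · linarith [large J (2 * s) h.le]
  rcases le_or_gt s 1 with h | h
  · linarith [small J s hs h]
  · linarith [large J s h.le]

/-- The dilation `t ↦ g (s t)` of a Schwartz function on the line. -/
noncomputable def dilate (s : ℝ) (hs : s ≠ 0) (g : 𝓢(ℝ, ℂ)) : 𝓢(ℝ, ℂ) :=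
  SchwartzMap.compCLMOfContinuousLinearEquiv ℂ
    (ContinuousLinearEquiv.unitsEquivAut ℝ (Units.mk0 s hs)) g

theorem dilate_apply (s : ℝ) (hs : s ≠ 0) (g : 𝓢(ℝ, ℂ)) (t : ℝ) : dilate s hs g t = g (t * s) := by
  simp [dilate]

theorem fourier_dilate (s : ℝ) (hs : s ≠ 0) (g : 𝓢(ℝ, ℂ)) (τ : ℝ) :
    𝓕 (dilate s hs g) τ = |s⁻¹| • 𝓕 g (τ * s⁻¹) := by
  rw [SchwartzMap.fourier_coe, SchwartzMap.fourier_coe, Real.fourier_real_eq, Real.fourier_real_eq,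
    ← Measure.integral_comp_mul_right]
  refine integral_congr_ae (.of_forall fun v => ?_)
  simp only [dilate_apply]
  congr 3
  field_simp

/-- A Schwartz function vanishing at the origin is small near the origin and at infinity. -/
theorem exists_bound_min_of_apply_zero (g : 𝓢(ℝ, ℂ)) (h0 : g 0 = 0) :
    ∃ C : ℝ, 0 ≤ C ∧ ∀ t, ‖g t‖ ≤ C * min |t| |t|⁻¹ := by
  obtain ⟨C₁, hC₁, h₁⟩ := g.decay 1 0
  obtain ⟨C₂, hC₂, h₂⟩ := g.decay 0 1
  refine ⟨C₁ + C₂, by positivity, fun t => ?_⟩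
  rcases eq_or_ne t 0 with rfl | ht
  · simp [h0]
  have ht' : 0 < |t| := abs_pos.2 ht
  rw [mul_min_of_nonneg _ _ (by positivity), le_min_iff]
  constructor
  · have h3 : ‖g t - g 0‖ ≤ C₂ * ‖t - 0‖ := by
      refine (convex_univ : Convex ℝ (Set.univ : Set ℝ)).norm_image_sub_le_of_norm_fderiv_le
        (𝕜 := ℝ) (fun x _ => g.differentiableAt) (fun x _ => ?_) (Set.mem_univ _) (Set.mem_univ _)
      have := h₂ x
      rwa [pow_zero, one_mul, norm_iteratedFDeriv_one] at this
    rw [h0, sub_zero, sub_zero, Real.norm_eq_abs] at h3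
    nlinarith
  · have h4 := h₁ t
    rw [pow_one, norm_iteratedFDeriv_zero, Real.norm_eq_abs] at h4
    rw [← div_eq_mul_inv, le_div_iff₀ ht']
    linarith

/-- A dyadic resolution of the constant function `1` on the line whose pieces, except for the
first, have mean zero. -/
theorem exists_dyadic_resolution (b : ℝ) (hb : 0 ≤ b) : ∃ φ : ℕ → 𝓢(ℝ, ℂ),
    (∃ C : ℝ, 0 ≤ C ∧ ∀ J τ, ∑ j ∈ Finset.range J, ((2 : ℝ) ^ j)⁻¹ * ‖𝓕 (φ j) τ‖ ≤ C) ∧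
    (∃ C : ℝ, 0 ≤ C ∧ ∀ J t,
      ∑ j ∈ Finset.range J, ((2 : ℝ) ^ j) ^ b * ‖φ j t‖ ≤ C * (1 + |t| ^ b)) ∧
    (∃ C : ℝ, ∀ J t, ‖∑ j ∈ Finset.range J, φ j t‖ ≤ C) ∧
    ∀ t, Filter.Tendsto (fun J => ∑ j ∈ Finset.range J, φ j t) Filter.atTop (nhds 1) := by
  let η : ContDiffBump (0 : ℝ) := ⟨2, 4, by norm_num, by norm_num⟩
  set β : 𝓢(ℝ, ℂ) := (η.hasCompactSupport.comp_left (g := fun x : ℝ => (x : ℂ))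
    Complex.ofReal_zero).toSchwartzMap (Complex.ofRealCLM.contDiff.comp η.contDiff) with hβ
  have hβ1 : ∀ t : ℝ, |t| ≤ 2 → β t = 1 := by
    intro t ht
    have : β t = ((η t : ℝ) : ℂ) := rfl
    rw [this, η.one_of_mem_closedBall (by simpa [η] using ht)]
    simp
  have h2 : (2 : ℝ) ≠ 0 := two_ne_zero
  -- The dilate has twice the integral of `β`, so `χ` has mean zero, while near the origin it equals
  -- `2 - 1 = 1`. Mean zero is needed because the weighted sum of the transforms is essentially `∑
  -- |𝓕 φ₁ (2^j τ)|`, bounded uniformly near `τ = 0` only if `𝓕 φ₁` vanishes there.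
  set χ : 𝓢(ℝ, ℂ) := (2 : ℂ) • β - dilate 2⁻¹ (inv_ne_zero h2) β with hχ
  have hχ_apply : ∀ t, χ t = 2 * β t - β (t * 2⁻¹) := fun t => by
    simp [hχ, dilate_apply]
  have hχ1 : ∀ t : ℝ, |t| ≤ 2 → χ t = 1 := by
    intro t ht
    rw [hχ_apply, hβ1 t ht, hβ1]
    · norm_num
    · rw [abs_mul, abs_inv, abs_two]
      linarith
  have hχ0 : 𝓕 χ 0 = 0 := by
    have h1 : 𝓕 χ = (2 : ℂ) • 𝓕 β - 𝓕 (dilate 2⁻¹ (inv_ne_zero h2) β) := by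
      rw [hχ, ← FourierTransform.fourierCLM_apply (R := ℂ), map_sub, map_smul]
      rfl
    rw [h1, sub_apply, smul_apply, fourier_dilate]
    simp
  set φ₁ : 𝓢(ℝ, ℂ) := χ - dilate 2 h2 χ with hφ₁
  have hφ₁_apply : ∀ t, φ₁ t = χ t - χ (t * 2) := fun t => by
    simp [hφ₁, dilate_apply]
  have hφ₁0 : 𝓕 φ₁ 0 = 0 := by
    have h1 : 𝓕 φ₁ = 𝓕 χ - 𝓕 (dilate 2 h2 χ) := by
      rw [hφ₁, ← FourierTransform.fourierCLM_apply (R := ℂ), map_sub]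
      rfl
    rw [h1, sub_apply, fourier_dilate]
    simp [hχ0]
  have hφ₁small : ∀ t : ℝ, |t| ≤ 1 → φ₁ t = 0 := by
    intro t ht
    rw [hφ₁_apply, hχ1 t (by linarith), hχ1, sub_self]
    rw [abs_mul, abs_two]
    linarith
  have hne : ∀ j : ℕ, ((2 : ℝ) ^ j)⁻¹ ≠ 0 := fun j => inv_ne_zero (pow_ne_zero _ h2)
  obtain ⟨A, hA0, hA⟩ := exists_bound_min_of_apply_zero (𝓕 φ₁) hφ₁0
  obtain ⟨B, hB0, hB⟩ := exists_bound_min_of_apply_zero φ₁ (hφ₁small 0 (by simp))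
  obtain ⟨D, hD0, hD⟩ := (𝓕 χ).decay 0 0
  obtain ⟨D', hD0', hD'⟩ := χ.decay 0 0
  simp only [pow_zero, one_mul, norm_iteratedFDeriv_zero] at hD hD'
  set φ : ℕ → 𝓢(ℝ, ℂ) := fun j => if j = 0 then χ else dilate ((2 : ℝ) ^ j)⁻¹ (hne j) φ₁ with hφ
  have hφ0 : φ 0 = χ := by simp [hφ]
  have hφs : ∀ j, φ (j + 1) = dilate ((2 : ℝ) ^ (j + 1))⁻¹ (hne (j + 1)) φ₁ := fun j => by
    simp [hφ]
  -- The sum telescopes to a dilate of `χ`, which tends to `χ 0 = 1`.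
  have hsum : ∀ J t, ∑ j ∈ Finset.range (J + 1), φ j t = χ (t * ((2 : ℝ) ^ J)⁻¹) := by
    intro J t
    induction J with
    | zero => simp [hφ0]
    | succ J ih =>
      rw [Finset.sum_range_succ, ih, hφs, dilate_apply, hφ₁_apply]
      have : t * ((2 : ℝ) ^ (J + 1))⁻¹ * 2 = t * ((2 : ℝ) ^ J)⁻¹ := by
        rw [pow_succ]
        field_simp
      rw [this]
      ring
  refine ⟨φ, ⟨D + A * 4, by positivity, ?_⟩, ⟨D' + B * 4, by positivity, ?_⟩,
    ⟨D', ?_⟩, ?_⟩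
  · intro J τ
    rcases J with _ | J
    · simp
      positivity
    rw [Finset.sum_range_succ', hφ0, add_comm]
    refine add_le_add (by simpa using hD τ) ?_
    calc ∑ j ∈ Finset.range J, ((2 : ℝ) ^ (j + 1))⁻¹ * ‖𝓕 (φ (j + 1)) τ‖
        ≤ ∑ j ∈ Finset.range J, A * min (2 ^ j * (2 * |τ|)) (2 ^ j * (2 * |τ|))⁻¹ := by
          refine Finset.sum_le_sum fun j _ => ?_
          rw [hφs, fourier_dilate, inv_inv, norm_smul, Real.norm_eq_abs, abs_abs,
            abs_of_pos (by positivity), ← mul_assoc, inv_mul_cancel₀ (by positivity), one_mul]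
          refine (hA _).trans (le_of_eq ?_)
          rw [abs_mul, abs_of_pos (show (0 : ℝ) < 2 ^ (j + 1) by positivity), pow_succ]
          congr 2 <;> ring
      _ = A * ∑ j ∈ Finset.range J, min (2 ^ j * (2 * |τ|)) (2 ^ j * (2 * |τ|))⁻¹ := by
          rw [Finset.mul_sum]
      _ ≤ A * 4 := by
          gcongr
          exact sum_min_two_pow_le (by positivity) J
  · intro J t
    rcases J with _ | J
    · simp
      positivity
    have hpow : 0 ≤ |t| ^ b := by positivity
    have hrest : ∑ j ∈ Finset.range J, ((2 : ℝ) ^ (j + 1)) ^ b * ‖φ (j + 1) t‖ ≤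
        B * 4 * |t| ^ b := by
      calc ∑ j ∈ Finset.range J, ((2 : ℝ) ^ (j + 1)) ^ b * ‖φ (j + 1) t‖
          ≤ ∑ j ∈ Finset.range J, B * |t| ^ b *
              min (2 ^ j * (2 * |t|⁻¹)) (2 ^ j * (2 * |t|⁻¹))⁻¹ := by
            refine Finset.sum_le_sum fun j _ => ?_
            rw [hφs, dilate_apply]
            set x : ℝ := t * ((2 : ℝ) ^ (j + 1))⁻¹ with hx
            have hp : (0 : ℝ) < 2 ^ (j + 1) := by positivity
            have hxabs : |x| = |t| * ((2 : ℝ) ^ (j + 1))⁻¹ := by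
              rw [hx, abs_mul, abs_inv, abs_of_pos hp]
            have hmin : min (2 ^ j * (2 * |t|⁻¹)) (2 ^ j * (2 * |t|⁻¹))⁻¹ = min |x| |x|⁻¹ := by
              rw [min_comm, hxabs, pow_succ]
              congr 1
              · simp
                ring
              · simp
                ring
            have hprod : ((2 : ℝ) ^ (j + 1)) ^ b * |x| ^ b = |t| ^ b := by
              rw [← Real.mul_rpow (by positivity) (by positivity), hxabs]
              congr 1
              field_simp
            rw [hmin]
            -- The piece vanishes for `|x| ≤ 1`. Otherwise inserting `|x| ^ b ≥ 1` turns the weight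
            -- into exactly `|t| ^ b`.
            rcases le_or_gt |x| 1 with h | h
            · rw [hφ₁small x h, norm_zero, mul_zero]
              positivity
            · calc ((2 : ℝ) ^ (j + 1)) ^ b * ‖φ₁ x‖
                  ≤ ((2 : ℝ) ^ (j + 1)) ^ b * (|x| ^ b * (B * min |x| |x|⁻¹)) := by
                    gcongr
                    exact (hB x).trans (le_mul_of_one_le_left (by positivity)
                      (Real.one_le_rpow h.le hb))
                _ = ((2 : ℝ) ^ (j + 1)) ^ b * |x| ^ b * (B * min |x| |x|⁻¹) := by ring
                _ = _ := by rw [hprod]; ring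
        _ = B * |t| ^ b * ∑ j ∈ Finset.range J,
              min (2 ^ j * (2 * |t|⁻¹)) (2 ^ j * (2 * |t|⁻¹))⁻¹ := by rw [Finset.mul_sum]
        _ ≤ B * |t| ^ b * 4 := by
            gcongr
            exact sum_min_two_pow_le (by positivity) J
        _ = _ := by ring
    rw [Finset.sum_range_succ', hφ0]
    have h1 : ((2 : ℝ) ^ 0) ^ b * ‖χ t‖ ≤ D' := by simpa using hD' t
    nlinarith [mul_nonneg hD0'.le hpow]
  · intro J t
    rcases J with _ | J
    · simp
      exact hD0'.le
    rw [hsum]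
    exact hD' _
  · intro t
    rw [← Filter.tendsto_add_atTop_iff_nat 1]
    simp only [hsum]
    have h1 : Filter.Tendsto (fun J : ℕ => t * ((2 : ℝ) ^ J)⁻¹) Filter.atTop (nhds (t * 0)) := by
      refine tendsto_const_nhds.mul ?_
      have := tendsto_pow_atTop_nhds_zero_of_lt_one (r := (2 : ℝ)⁻¹) (by norm_num) (by norm_num)
      simpa [inv_pow] using this
    have h2 := (χ.continuous.tendsto (t * 0)).comp h1
    rw [mul_zero, hχ1 0 (by simp)] at h2
    exact h2

end LittlewoodPaley

/-! ### The restriction estimate for a compactly supported density. -/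

section WeightedEstimate

open scoped RealInnerProductSpace

variable {d : ℕ} {a ψ : EuclideanSpace ℝ (Fin d) → ℝ}

theorem norm_smearedDensity_le {A : ℝ} (hA : ∀ ξ, |a ξ| ≤ A) {φ : 𝓢(ℝ, ℂ)} {M : ℝ}
    (hM : ∀ τ, ‖𝓕 φ τ‖ ≤ M) (ζ : EuclideanSpace ℝ (Fin (d + 1))) :
    ‖smearedDensity a ψ φ ζ‖ ≤ A * M := by
  rw [smearedDensity, norm_mul, Complex.norm_real]
  exact mul_le_mul (hA _) (hM _) (norm_nonneg _) ((abs_nonneg _).trans (hA 0))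

/-- The bilinear estimate for the Fourier transform of a surface measure, for simple functions. -/
theorem exists_bilinear_bound (hψ : Continuous ψ) (ha : Continuous a) (ca : HasCompactSupport a)
    {b D : ℝ} (hdecay : ∀ y : EuclideanSpace ℝ (Fin (d + 1)),
      |y (Fin.last d)| ^ b * ‖surfaceKernel a ψ y‖ ≤ D)
    {p θ : ℝ} (hθ₀ : 0 < θ) (hθ₁ : θ ≤ 1) (hp : p * (1 + θ) = 2) (hb : (1 - θ) / θ ≤ b) :
    ∃ C : ℝ, 0 ≤ C ∧ ∀ f g : SimpleFunc (EuclideanSpace ℝ (Fin (d + 1))) ℂ, Integrable f →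
      Integrable g →
      ‖∫ q : EuclideanSpace ℝ (Fin (d + 1)) × EuclideanSpace ℝ (Fin (d + 1)),
        f q.1 * g q.2 * surfaceKernel a ψ (q.2 - q.1)‖ ≤
        C * ((∫ x, ‖f x‖ ^ p) ^ (1 / p) * (∫ x, ‖g x‖ ^ p) ^ (1 / p)) := by
  have hβ0 : 0 ≤ (1 - θ) / θ := div_nonneg (by linarith) hθ₀.le
  obtain ⟨φ, ⟨C₀, hC₀, h₀⟩, ⟨C₁, hC₁, h₁⟩, ⟨C₂, h₂⟩, hlim⟩ :=
    exists_dyadic_resolution ((1 - θ) / θ) hβ0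
  obtain ⟨A, hA⟩ := ha.bounded_above_of_compact_support ca
  have hA0 : 0 ≤ A := (norm_nonneg _).trans (hA 0)
  have ia : Integrable a := ha.integrable_of_hasCompactSupport ca
  set K₀ : ℝ := ∫ ξ, |a ξ| with hK₀
  have hK₀0 : 0 ≤ K₀ := integral_nonneg fun _ => abs_nonneg _
  have hK : ∀ y, ‖surfaceKernel a ψ y‖ ≤ K₀ := norm_surfaceKernel_le
  have hKcont := continuous_surfaceKernel hψ ia
  have hD0 : 0 ≤ D := le_trans (by positivity) (hdecay 0)
  -- For `|y_last| ≤ 1` the trivial bound `K₀` suffices; beyond that, the decay exponent `b`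
  -- dominates the interpolation exponent `(1 - θ) / θ`.
  have hKdecay : ∀ y : EuclideanSpace ℝ (Fin (d + 1)),
      ‖surfaceKernel a ψ y‖ * (1 + |y (Fin.last d)| ^ ((1 - θ) / θ)) ≤ 2 * K₀ + D := by
    intro y
    have hn := norm_nonneg (surfaceKernel a ψ y)
    rcases le_or_gt |y (Fin.last d)| 1 with h | h
    · have h3 : |y (Fin.last d)| ^ ((1 - θ) / θ) ≤ 1 := Real.rpow_le_one (abs_nonneg _) h hβ0
      have := hK y
      nlinarith
    · have h3 : |y (Fin.last d)| ^ ((1 - θ) / θ) ≤ |y (Fin.last d)| ^ b :=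
        Real.rpow_le_rpow_of_exponent_le h.le hb
      have := hK y
      have := hdecay y
      nlinarith
  set k : ℕ → EuclideanSpace ℝ (Fin (d + 1)) × EuclideanSpace ℝ (Fin (d + 1)) → ℂ := fun j q =>
    surfaceKernel a ψ (q.2 - q.1) * φ j ((q.2 - q.1) (Fin.last d)) with hk
  have hlast : Continuous fun y : EuclideanSpace ℝ (Fin (d + 1)) => y (Fin.last d) := by fun_prop
  have hkc : ∀ j, Continuous (k j) := fun j =>
    (hKcont.comp (continuous_snd.sub continuous_fst)).mul
      ((φ j).continuous.comp (hlast.comp (continuous_snd.sub continuous_fst)))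
  have hkb : ∀ j, ∃ C : ℝ, ∀ q, ‖k j q‖ ≤ C := by
    intro j
    obtain ⟨B, hB0, hB⟩ := (φ j).decay 0 0
    simp only [pow_zero, one_mul, norm_iteratedFDeriv_zero] at hB
    refine ⟨K₀ * B, fun q => ?_⟩
    rw [hk, norm_mul]
    exact mul_le_mul (hK _) (hB _) (norm_nonneg _) hK₀0
  have hpow2 : ∀ j : ℕ, (0 : ℝ) < 2 ^ j := fun j => by positivity
  have bound : ∀ (J : ℕ) (f g : SimpleFunc (EuclideanSpace ℝ (Fin (d + 1))) ℂ), Integrable f →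
      Integrable g →
      ‖∫ q : EuclideanSpace ℝ (Fin (d + 1)) × EuclideanSpace ℝ (Fin (d + 1)),
        f q.1 * g q.2 * ∑ j ∈ Finset.range J, k j q‖ ≤
        (A * C₀) ^ (1 - θ) * ((2 * K₀ + D) * C₁) ^ θ *
          ((∫ x, ‖f x‖ ^ p) ^ (1 / p) * (∫ x, ‖g x‖ ^ p) ^ (1 / p)) := by
    intro J f g hf hg
    have hst := stein_interpolation (μ := (volume : Measure (EuclideanSpace ℝ (Fin (d + 1)))))
      (Finset.range J) k (fun j => (hkc j).aestronglyMeasurable) hkb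
      (fun j => ((2 : ℝ) ^ j)⁻¹) (fun j => ((2 : ℝ) ^ j) ^ ((1 - θ) / θ))
      (fun j => by positivity) (fun j => by positivity) (M₀ := A * C₀)
      (M₁ := (2 * K₀ + D) * C₁) (by positivity) (by positivity) ?_ ?_ hθ₀.le hθ₁ hp f g hf hg
    -- The growth exponent `(1 - θ) / θ` is chosen precisely so that the interpolated weights are
    -- all one.
    · have hw : ∀ j : ℕ, (((2 : ℝ) ^ j)⁻¹ ^ (1 - θ) * (((2 : ℝ) ^ j) ^ ((1 - θ) / θ)) ^ θ : ℝ) = 1 := by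
        intro j
        rw [← Real.rpow_mul (hpow2 j).le, div_mul_cancel₀ _ hθ₀.ne', Real.inv_rpow (hpow2 j).le,
          inv_mul_cancel₀ (Real.rpow_pos_of_pos (hpow2 j) _).ne']
      simp only [hw, Complex.ofReal_one, one_mul] at hst
      exact hst
    · intro c hc f g hf hg
      -- Absorbing the coefficients into one Schwartz function turns the `L²` endpoint into a single
      -- multiplier, the density smeared by `𝓕 Φ`.
      set Φ : 𝓢(ℝ, ℂ) := ∑ j ∈ Finset.range J, c j • φ j with hΦ
      have hFΦ : ∀ τ, ‖𝓕 Φ τ‖ ≤ C₀ := by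
        intro τ
        have : 𝓕 Φ = ∑ j ∈ Finset.range J, c j • 𝓕 (φ j) := by
          rw [hΦ, ← FourierTransform.fourierCLM_apply (R := ℂ), map_sum]
          simp only [map_smul]
          rfl
        rw [this, sum_apply]
        refine (norm_sum_le _ _).trans (le_trans (le_of_eq ?_) (h₀ J τ))
        refine Finset.sum_congr rfl fun j _ => ?_
        rw [smul_apply, norm_smul, hc]
      have h3 := norm_integral_multiplier_le (integrable_smearedDensity hψ.measurable ia Φ)
        (norm_smearedDensity_le (ψ := ψ) hA hFΦ) hf
        ((SimpleFunc.memLp_iff_integrable two_ne_zero ENNReal.ofNat_ne_top).2 hf) hg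
        ((SimpleFunc.memLp_iff_integrable two_ne_zero ENNReal.ofNat_ne_top).2 hg)
      simp only [fourierInv_smearedDensity hψ.measurable] at h3
      convert h3 using 2
      refine integral_congr_ae (.of_forall fun q => ?_)
      simp only [hk, hΦ, sum_apply, smul_apply, smul_eq_mul]
      rw [Finset.mul_sum, Finset.mul_sum, Finset.mul_sum]
      refine Finset.sum_congr rfl fun j _ => ?_
      ring
    · intro c hc f g hf hg
      refine norm_integral_kernel_le (k := fun y => ∑ j ∈ Finset.range J,
        c j * (surfaceKernel a ψ y * φ j (y (Fin.last d)))) (fun y => ?_) hf hg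
      calc ‖∑ j ∈ Finset.range J, c j * (surfaceKernel a ψ y * φ j (y (Fin.last d)))‖
          ≤ ∑ j ∈ Finset.range J, ‖surfaceKernel a ψ y‖ *
              (((2 : ℝ) ^ j) ^ ((1 - θ) / θ) * ‖φ j (y (Fin.last d))‖) := by
            refine norm_sum_le_of_le _ fun j _ => le_of_eq ?_
            rw [norm_mul, norm_mul, hc]
            ring
        _ = ‖surfaceKernel a ψ y‖ * ∑ j ∈ Finset.range J,
              (((2 : ℝ) ^ j) ^ ((1 - θ) / θ) * ‖φ j (y (Fin.last d))‖) := by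
            rw [Finset.mul_sum]
        _ ≤ ‖surfaceKernel a ψ y‖ * (C₁ * (1 + |y (Fin.last d)| ^ ((1 - θ) / θ))) := by
            gcongr
            exact h₁ J _
        _ = ‖surfaceKernel a ψ y‖ * (1 + |y (Fin.last d)| ^ ((1 - θ) / θ)) * C₁ := by ring
        _ ≤ (2 * K₀ + D) * C₁ := by
            gcongr
            exact hKdecay y
  refine ⟨(A * C₀) ^ (1 - θ) * ((2 * K₀ + D) * C₁) ^ θ, by positivity, fun f g hf hg => ?_⟩
  -- The bound does not depend on `J`, so dominated convergence recovers the full kernel.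
  refine le_of_tendsto (x := Filter.atTop) (Filter.Tendsto.norm ?_) (.of_forall fun J => bound J f g hf hg)
  refine tendsto_integral_of_dominated_convergence (fun q => ‖f q.1‖ * ‖g q.2‖ * (K₀ * C₂))
    (fun J => ?_) ((hf.norm.mul_prod hg.norm).mul_const _) (fun J => .of_forall fun q => ?_)
    (.of_forall fun q => ?_)
  · refine AEStronglyMeasurable.mul ?_
      (continuous_finsetSum _ fun j _ => hkc j).aestronglyMeasurable
    exact (hf.mul_prod hg).aestronglyMeasurable
  · simp only [hk]
    rw [← Finset.mul_sum, norm_mul, norm_mul, norm_mul]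
    gcongr
    · exact hK _
    · exact h₂ J _
  · simp only [hk, ← Finset.mul_sum]
    have := (hlim ((q.2 - q.1) (Fin.last d))).const_mul
      (f q.1 * g q.2 * surfaceKernel a ψ (q.2 - q.1))
    simpa only [mul_assoc, mul_one] using this

theorem fourierInv_conj {V : Type*} [NormedAddCommGroup V] [InnerProductSpace ℝ V]
    [FiniteDimensional ℝ V] [MeasurableSpace V] [BorelSpace V] (f : V → ℂ) (w : V) :
    𝓕⁻ (fun x => (starRingEnd ℂ) (f x)) w = (starRingEnd ℂ) (𝓕 f w) := by
  rw [Real.fourierInv_eq, Real.fourier_eq, ← integral_conj]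
  refine integral_congr_ae (.of_forall fun x => ?_)
  simp only [Circle.smul_def, smul_eq_mul, map_mul, AddChar.map_neg_eq_inv, Circle.coe_inv_eq_conj,
    Complex.conj_conj]

/-- The restriction estimate for a smooth density on the graph of `ψ`, for simple functions. -/
theorem exists_weighted_bound_simpleFunc (hψ : Continuous ψ) (ha : Continuous a)
    (ca : HasCompactSupport a)
    {b D : ℝ} (hdecay : ∀ y : EuclideanSpace ℝ (Fin (d + 1)),
      |y (Fin.last d)| ^ b * ‖surfaceKernel a ψ y‖ ≤ D)
    {p θ : ℝ} (hθ₀ : 0 < θ) (hθ₁ : θ ≤ 1) (hp : p * (1 + θ) = 2) (hb : (1 - θ) / θ ≤ b) :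
    ∃ C : ℝ, 0 ≤ C ∧ ∀ f : SimpleFunc (EuclideanSpace ℝ (Fin (d + 1))) ℂ, Integrable f →
      ∫ ξ, a ξ * ‖𝓕 (f : EuclideanSpace ℝ (Fin (d + 1)) → ℂ) (graphPoint ψ ξ)‖ ^ 2 ≤
        C * ((∫ x, ‖f x‖ ^ p) ^ (1 / p)) ^ 2 := by
  obtain ⟨C, hC, h⟩ := exists_bilinear_bound hψ ha ca hdecay hθ₀ hθ₁ hp hb
  refine ⟨C, hC, fun f hf => ?_⟩
  have ia : Integrable a := ha.integrable_of_hasCompactSupport ca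
  have hconj : ∀ x, f.map (starRingEnd ℂ) x = (starRingEnd ℂ) (f x) := fun x => rfl
  have hfc : Integrable (f.map (starRingEnd ℂ)) := by
    simp only [SimpleFunc.coe_map]
    exact Complex.conjCLE.integrable_comp_iff.2 hf
  -- Testing against the conjugate of `f` turns the form into the integral of `a |𝓕 f|²` over the
  -- graph.
  have h1 := h f (f.map (starRingEnd ℂ)) hf hfc
  have h2 : ∫ q : EuclideanSpace ℝ (Fin (d + 1)) × EuclideanSpace ℝ (Fin (d + 1)),
      f q.1 * f.map (starRingEnd ℂ) q.2 * surfaceKernel a ψ (q.2 - q.1) = _ :=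
    integral_kernel_eq (ν := (volume : Measure (EuclideanSpace ℝ (Fin d))))
      (Γ := graphPoint ψ) (continuous_graphPoint hψ).measurable.aemeasurable
      (m := fun ξ => (a ξ : ℂ)) ia.ofReal hf hfc
  rw [h2] at h1
  have h3 : ∀ ξ, (a ξ : ℂ) * (𝓕 (f : EuclideanSpace ℝ (Fin (d + 1)) → ℂ) (graphPoint ψ ξ) *
      𝓕⁻ (f.map (starRingEnd ℂ) : EuclideanSpace ℝ (Fin (d + 1)) → ℂ) (graphPoint ψ ξ)) =
      ((a ξ * ‖𝓕 (f : EuclideanSpace ℝ (Fin (d + 1)) → ℂ) (graphPoint ψ ξ)‖ ^ 2 : ℝ) : ℂ) := by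
    intro ξ
    have h4 : (f.map (starRingEnd ℂ) : EuclideanSpace ℝ (Fin (d + 1)) → ℂ) =
      fun x => (starRingEnd ℂ) (f x) := rfl
    rw [h4, fourierInv_conj, Complex.mul_conj, Complex.normSq_eq_norm_sq]
    push_cast
    ring
  simp only [h3, hconj, RCLike.norm_conj] at h1
  rw [integral_complex_ofReal, Complex.norm_real] at h1
  rw [sq ((∫ x, ‖f x‖ ^ p) ^ (1 / p))]
  exact (le_abs_self _).trans h1

/-- The restriction estimate for a smooth density on the graph of `ψ`. -/
theorem exists_weighted_bound (hψ : Continuous ψ) (ha : Continuous a)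
    (ca : HasCompactSupport a) (ha0 : ∀ ξ, 0 ≤ a ξ)
    {b D : ℝ} (hdecay : ∀ y : EuclideanSpace ℝ (Fin (d + 1)),
      |y (Fin.last d)| ^ b * ‖surfaceKernel a ψ y‖ ≤ D)
    {p θ : ℝ} (hθ₀ : 0 < θ) (hθ₁ : θ ≤ 1) (hp : p * (1 + θ) = 2) (hb : (1 - θ) / θ ≤ b) :
    ∃ C : ℝ, 0 ≤ C ∧ ∀ f : EuclideanSpace ℝ (Fin (d + 1)) → ℂ, Continuous f → Integrable f →
      Integrable (fun x => ‖f x‖ ^ p) →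
      ∫ ξ, a ξ * ‖𝓕 f (graphPoint ψ ξ)‖ ^ 2 ≤ C * ((∫ x, ‖f x‖ ^ p) ^ (1 / p)) ^ 2 := by
  obtain ⟨C, hC, h⟩ := exists_weighted_bound_simpleFunc hψ ha ca hdecay hθ₀ hθ₁ hp hb
  have hp0 : 0 < p := by
    by_contra! h
    nlinarith
  refine ⟨C * ((((2 : ℝ) ^ p) ^ (1 / p)) ^ 2), by positivity, fun f cf hf hfp => ?_⟩
  -- These approximations are dominated by `2 * ‖f‖`, which justifies both limits below and accounts
  -- for the factor `2 ^ p` in the constant.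
  set s : ℕ → SimpleFunc (EuclideanSpace ℝ (Fin (d + 1))) ℂ := fun n =>
    SimpleFunc.approxOn f cf.measurable Set.univ 0 (Set.mem_univ 0) n with hs
  have hsn : ∀ n x, ‖s n x‖ ≤ 2 * ‖f x‖ := fun n x => by
    have := SimpleFunc.norm_approxOn_zero_le cf.measurable (Set.mem_univ (0 : ℂ)) x n
    rwa [← two_mul] at this
  have hslim : ∀ x, Filter.Tendsto (fun n => s n x) Filter.atTop (nhds (f x)) := fun x =>
    SimpleFunc.tendsto_approxOn cf.measurable (Set.mem_univ 0) (by simp)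
  have his : ∀ n, Integrable (s n) := fun n =>
    (hf.norm.const_mul 2).mono' (s n).aestronglyMeasurable (.of_forall (hsn n))
  have hFlim : ∀ ζ, Filter.Tendsto
      (fun n => 𝓕 (s n : EuclideanSpace ℝ (Fin (d + 1)) → ℂ) ζ) Filter.atTop (nhds (𝓕 f ζ)) := by
    intro ζ
    simp only [Real.fourier_eq]
    refine tendsto_integral_of_dominated_convergence (fun x => 2 * ‖f x‖) (fun n => ?_)
      (hf.norm.const_mul 2) (fun n => .of_forall fun x => ?_) (.of_forall fun x => ?_)
    · exact ((Real.fourierIntegral_convergent_iff ζ).2 (his n)).aestronglyMeasurable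
    · rw [Circle.norm_smul]
      exact hsn n x
    · exact (hslim x).const_smul _
  have hFb : ∀ n ζ, ‖𝓕 (s n : EuclideanSpace ℝ (Fin (d + 1)) → ℂ) ζ‖ ≤ 2 * ∫ x, ‖f x‖ := by
    intro n ζ
    rw [Real.fourier_eq, ← integral_const_mul]
    refine norm_integral_le_of_norm_le (hf.norm.const_mul 2) (.of_forall fun x => ?_)
    rw [Circle.norm_smul]
    exact hsn n x
  have ia : Integrable a := ha.integrable_of_hasCompactSupport ca
  have hlim : Filter.Tendsto (fun n => ∫ ξ, a ξ *
      ‖𝓕 (s n : EuclideanSpace ℝ (Fin (d + 1)) → ℂ) (graphPoint ψ ξ)‖ ^ 2) Filter.atTop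
      (nhds (∫ ξ, a ξ * ‖𝓕 f (graphPoint ψ ξ)‖ ^ 2)) := by
    refine tendsto_integral_of_dominated_convergence
      (fun ξ => a ξ * (2 * ∫ x, ‖f x‖) ^ 2) (fun n => ?_) (ia.mul_const _)
      (fun n => .of_forall fun ξ => ?_) (.of_forall fun ξ => ?_)
    · exact (ha.mul (((continuous_fourier_of_integrable (his n)).comp
        (continuous_graphPoint hψ)).norm.pow 2)).aestronglyMeasurable
    · rw [norm_mul, Real.norm_of_nonneg (ha0 ξ), norm_pow, norm_norm]
      have := ha0 ξ
      gcongr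
      exact hFb n _
    · exact ((hFlim _).norm.pow 2).const_mul _
  refine le_of_tendsto hlim (.of_forall fun n => (h (s n) (his n)).trans ?_)
  have h5 : ∫ x, ‖s n x‖ ^ p ≤ (2 : ℝ) ^ p * ∫ x, ‖f x‖ ^ p := by
    rw [← integral_const_mul]
    refine integral_mono_of_nonneg (.of_forall fun x => by positivity) (hfp.const_mul _)
      (.of_forall fun x => ?_)
    simp only
    rw [← Real.mul_rpow (by norm_num) (norm_nonneg _)]
    exact Real.rpow_le_rpow (norm_nonneg _) (hsn n x) hp0.le
  have h6 : 0 ≤ ∫ x, ‖s n x‖ ^ p := integral_nonneg fun x => by positivity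
  have h7 : 0 ≤ ∫ x, ‖f x‖ ^ p := integral_nonneg fun x => by positivity
  calc C * ((∫ x, ‖s n x‖ ^ p) ^ (1 / p)) ^ 2
      ≤ C * (((2 : ℝ) ^ p * ∫ x, ‖f x‖ ^ p) ^ (1 / p)) ^ 2 := by gcongr
    _ = _ := by
        rw [Real.mul_rpow (by positivity) h7]
        ring

end WeightedEstimate

/-! ### Local estimates for nondegenerate graphs and their patching. -/

section Graph

open scoped RealInnerProductSpace

variable {d : ℕ}

theorem surfaceKernel_eq (a ψ : EuclideanSpace ℝ (Fin d) → ℝ)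
    (y : EuclideanSpace ℝ (Fin (d + 1))) :
    surfaceKernel a ψ y = ∫ ξ, Complex.exp
      ((((2 * Real.pi) • innerSL ℝ (baseProj y)) ξ + (2 * Real.pi * y (Fin.last d)) * ψ ξ : ℝ) *
        Complex.I) * (a ξ : ℂ) := by
  refine integral_congr_ae (.of_forall fun ξ => ?_)
  simp only [inner_graphPoint, Circle.smul_def, Real.fourierChar_apply, smul_eq_mul]
  congr 4
  simp only [smul_apply, innerSL_apply_apply, smul_eq_mul, real_inner_comm ξ]
  ring

/-- The horizontal part of `y` acts only as a linear perturbation of the phase, so uniformity in `l`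
leaves decay in the last coordinate alone. The factor `2π ≥ 1` in the frequency is discarded. -/
theorem rpow_mul_norm_surfaceKernel_le {a ψ : EuclideanSpace ℝ (Fin d) → ℝ} {C : ℝ}
    (hC : ∀ (l : EuclideanSpace ℝ (Fin d) →L[ℝ] ℝ) (t : ℝ),
        |t| ^ d * ‖∫ ξ, Complex.exp ((l ξ + t * ψ ξ : ℝ) * Complex.I) * (a ξ : ℂ)‖ ^ 2 ≤ C)
    (y : EuclideanSpace ℝ (Fin (d + 1))) :
    |y (Fin.last d)| ^ ((d : ℝ) / 2) * ‖surfaceKernel a ψ y‖ ≤ √C := by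
  refine Real.le_sqrt_of_sq_le ?_
  have h1 := hC ((2 * Real.pi) • innerSL ℝ (baseProj y)) (2 * Real.pi * y (Fin.last d))
  rw [← surfaceKernel_eq] at h1
  refine le_trans ?_ h1
  have h2 : (|y (Fin.last d)| ^ ((d : ℝ) / 2)) ^ 2 = |y (Fin.last d)| ^ d := by
    rw [← Real.rpow_natCast, ← Real.rpow_mul (abs_nonneg _), ← Real.rpow_natCast]
    congr 1
    push_cast
    ring
  rw [mul_pow, h2]
  refine mul_le_mul_of_nonneg_right (pow_le_pow_left₀ (abs_nonneg _) ?_ d) (by positivity)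
  rw [abs_mul]
  refine le_mul_of_one_le_left (abs_nonneg _) ?_
  rw [abs_of_pos (by positivity)]
  linarith [Real.pi_gt_three]

/-- The base integral in the restriction estimate for the graph of `ψ` over `s`. -/
def GraphEstimate (ψ : EuclideanSpace ℝ (Fin d) → ℝ) (p : ℝ≥0∞)
    (s : Set (EuclideanSpace ℝ (Fin d))) : Prop :=
  ∃ C : ℝ≥0, ∀ f : 𝓢(EuclideanSpace ℝ (Fin (d + 1)), ℂ),
    ∫⁻ ξ in s, ‖𝓕 (f : EuclideanSpace ℝ (Fin (d + 1)) → ℂ) (graphPoint ψ ξ)‖ₑ ^ 2 ≤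
      C * eLpNorm (f : EuclideanSpace ℝ (Fin (d + 1)) → ℂ) p volume ^ 2

theorem GraphEstimate.mono {ψ : EuclideanSpace ℝ (Fin d) → ℝ} {p : ℝ≥0∞}
    ⦃s t : Set (EuclideanSpace ℝ (Fin d))⦄ (hst : s ⊆ t) (h : GraphEstimate ψ p t) :
    GraphEstimate ψ p s := by
  obtain ⟨C, hC⟩ := h
  exact ⟨C, fun f => (lintegral_mono_set hst).trans (hC f)⟩

theorem GraphEstimate.union {ψ : EuclideanSpace ℝ (Fin d) → ℝ} {p : ℝ≥0∞}
    ⦃s : Set (EuclideanSpace ℝ (Fin d))⦄ (hs : GraphEstimate ψ p s)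
    ⦃t : Set (EuclideanSpace ℝ (Fin d))⦄ (ht : GraphEstimate ψ p t) :
    GraphEstimate ψ p (s ∪ t) := by
  obtain ⟨C, hC⟩ := hs
  obtain ⟨D, hD⟩ := ht
  refine ⟨C + D, fun f => (lintegral_union_le _ _ _).trans ?_⟩
  rw [ENNReal.coe_add, add_mul]
  exact add_le_add (hC f) (hD f)

/-- With `q = 2` the squared estimate is an integral, hence subadditive in the domain, which makes
patching of pieces possible. -/
theorem restrictionEstimate_iff_lintegral {n : ℕ} {σ : Measure (EuclideanSpace ℝ (Fin n))}
    {p : ℝ≥0∞} : RestrictionEstimate σ p 2 ↔ ∃ C : ℝ≥0, ∀ f : 𝓢(EuclideanSpace ℝ (Fin n), ℂ),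
      ∫⁻ x, ‖𝓕 (f : EuclideanSpace ℝ (Fin n) → ℂ) x‖ₑ ^ 2 ∂σ ≤
        C * eLpNorm (f : EuclideanSpace ℝ (Fin n) → ℂ) p volume ^ 2 := by
  have key : ∀ f : 𝓢(EuclideanSpace ℝ (Fin n), ℂ),
      eLpNorm (𝓕 (f : EuclideanSpace ℝ (Fin n) → ℂ)) 2 σ ^ 2 =
        ∫⁻ x, ‖𝓕 (f : EuclideanSpace ℝ (Fin n) → ℂ) x‖ₑ ^ 2 ∂σ := by
    intro f
    have := eLpNorm_nnreal_pow_eq_lintegral (f := 𝓕 (f : EuclideanSpace ℝ (Fin n) → ℂ)) (μ := σ)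
      (p := 2) two_ne_zero
    simpa using this
  simp only [← key]
  constructor
  · rintro ⟨C, hC⟩
    refine ⟨C ^ 2, fun f => ?_⟩
    have := pow_le_pow_left' (hC f) 2
    rwa [mul_pow] at this
  · rintro ⟨C, hC⟩
    refine ⟨NNReal.sqrt C, fun f => ?_⟩
    have h1 : ((NNReal.sqrt C : ℝ≥0) : ℝ≥0∞) ^ 2 = C := by
      rw [← ENNReal.coe_pow, NNReal.sq_sqrt]
    have h2 := hC f
    rw [← h1, ← mul_pow] at h2
    exact (ENNReal.pow_le_pow_left_iff two_ne_zero).1 h2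

theorem restrictionEstimate_graphMeasure {ψ : EuclideanSpace ℝ (Fin d) → ℝ} {p : ℝ≥0∞}
    {U : Set (EuclideanSpace ℝ (Fin d))} (h : GraphEstimate ψ p U) :
    RestrictionEstimate (graphMeasure U ψ) p 2 := by
  rw [restrictionEstimate_iff_lintegral]
  obtain ⟨C, hC⟩ := h
  refine ⟨C, fun f => le_trans (lintegral_map_le _ _) (hC f)⟩

/-- The Hessian of `ψ` at `ξ` is nondegenerate as a bilinear form. -/
def HessianNondegenerate (ψ : EuclideanSpace ℝ (Fin d) → ℝ) (ξ : EuclideanSpace ℝ (Fin d)) : Prop :=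
  ∀ h, (∀ k, fderiv ℝ (fun η => fderiv ℝ ψ η (EuclideanSpace.single k 1)) ξ h = 0) → h = 0

theorem hessianNondegenerate_of_det_ne_zero {ψ : EuclideanSpace ℝ (Fin d) → ℝ}
    {ξ : EuclideanSpace ℝ (Fin d)} (h : (hessian ψ ξ).det ≠ 0) : HessianNondegenerate ψ ξ := by
  intro v hv
  have h1 : Matrix.vecMul (fun j => v j) (hessian ψ ξ) = 0 := by
    ext k
    have h2 : v = ∑ j, v j • EuclideanSpace.single j (1 : ℝ) := by
      ext i
      simp [Pi.single_apply]
    have h3 := hv k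
    rw [h2, map_sum] at h3
    simpa [Matrix.vecMul, dotProduct, hessian] using h3
  have h4 := Matrix.eq_zero_of_vecMul_eq_zero h h1
  ext j
  exact congrFun h4 j

theorem HessianNondegenerate.congr {ψ ψ' : EuclideanSpace ℝ (Fin d) → ℝ}
    {ξ : EuclideanSpace ℝ (Fin d)} (h : HessianNondegenerate ψ ξ) (he : ψ' =ᶠ[nhds ξ] ψ) :
    HessianNondegenerate ψ' ξ := by
  intro v hv
  refine h v fun k => ?_
  have : (fun η => fderiv ℝ ψ' η (EuclideanSpace.single k 1)) =ᶠ[nhds ξ]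
      fun η => fderiv ℝ ψ η (EuclideanSpace.single k 1) :=
    (he.fderiv (𝕜 := ℝ)).mono fun η hη => by simp only [hη]
  rw [← this.fderiv_eq]
  exact hv k

/-- With `θ = 2/p - 1`, the condition `(1 - θ)/θ ≤ d/2` means `θ ≥ 2/(d + 2)`, which is `p ≤ 2(d +
2)/(d + 4)`, the exponent for `n = d + 1`. -/
theorem interpolation_exponent {p : ℝ} (hp1 : 1 ≤ p) (hp : p ≤ steinTomasExponent (d + 1)) :
    0 < 2 / p - 1 ∧ 2 / p - 1 ≤ 1 ∧ p * (1 + (2 / p - 1)) = 2 ∧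
      (1 - (2 / p - 1)) / (2 / p - 1) ≤ (d : ℝ) / 2 := by
  have hp0 : 0 < p := by linarith
  have hd : (0 : ℝ) ≤ d := Nat.cast_nonneg d
  have h1 : p * (d + 4) ≤ 2 * (d + 2) := by
    rw [steinTomasExponent, le_div_iff₀ (by positivity)] at hp
    push_cast at hp
    linarith
  have h2 : ((d : ℝ) + 4) / (d + 2) ≤ 2 / p := by
    rw [div_le_div_iff₀ (by positivity) hp0]
    linarith
  have h3 : 2 / ((d : ℝ) + 2) ≤ 2 / p - 1 := by
    have : ((d : ℝ) + 4) / (d + 2) = 1 + 2 / (d + 2) := by field_simp; ring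
    linarith
  have h4 : 0 < 2 / ((d : ℝ) + 2) := by positivity
  have hθ : 0 < 2 / p - 1 := by linarith
  refine ⟨hθ, ?_, by field_simp; ring, ?_⟩
  · have : 2 / p ≤ 2 := by
      rw [div_le_iff₀ hp0]
      linarith
    linarith
  · rw [div_le_iff₀ hθ]
    have h5 : 2 ≤ (2 / p - 1) * (d + 2) := by
      rwa [div_le_iff₀ (by positivity)] at h3
    linarith

/-- The restriction estimate near a point where the Hessian is nondegenerate. -/
theorem exists_ball_graphEstimate {p : ℝ} (hp1 : 1 ≤ p) (hp : p ≤ steinTomasExponent (d + 1))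
    {V : Set (EuclideanSpace ℝ (Fin d))} {ψ : EuclideanSpace ℝ (Fin d) → ℝ} (hV : IsOpen V)
    (hψ : ContDiffOn ℝ ∞ ψ V) {ξ₀ : EuclideanSpace ℝ (Fin d)} (hξ₀ : ξ₀ ∈ V)
    (hH : HessianNondegenerate ψ ξ₀) :
    ∃ r > 0, GraphEstimate ψ (ENNReal.ofReal p) (Metric.ball ξ₀ r) := by
  obtain ⟨hθ₀, hθ₁, hpθ, hb⟩ := interpolation_exponent hp1 hp
  have hp0 : 0 < p := by linarith
  obtain ⟨R, hR, hRV⟩ := Metric.nhds_basis_closedBall.mem_iff.1 (hV.mem_nhds hξ₀)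
  -- Cutting `ψ` off makes it smooth with compact support without changing it near `ξ₀`. The radius
  -- `r ≤ R` chosen later keeps the ball of radius `r / 2` where nothing was changed.
  let c : ContDiffBump ξ₀ := ⟨R / 2, R, by positivity, by linarith⟩
  set ψ' : EuclideanSpace ℝ (Fin d) → ℝ := fun ξ => c ξ * ψ ξ with hψ'
  have htc : tsupport c ⊆ Metric.closedBall ξ₀ R := c.tsupport_eq.subset
  have sψ' : ContDiff ℝ ∞ ψ' :=
    contDiff_of_tsupport_subset hV (tsupport_mul_subset_left.trans (htc.trans hRV))
      (c.contDiff.contDiffOn.mul hψ)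
  have cψ' : HasCompactSupport ψ' := c.hasCompactSupport.mul_right
  have heq : ∀ ξ ∈ Metric.closedBall ξ₀ (R / 2), ψ' ξ = ψ ξ := fun ξ hξ => by
    simp [hψ', c.one_of_mem_closedBall hξ]
  have hH' : HessianNondegenerate ψ' ξ₀ := by
    refine hH.congr ?_
    filter_upwards [Metric.closedBall_mem_nhds ξ₀ (half_pos hR)] with ξ hξ using heq ξ hξ
  obtain ⟨r₀, hr₀, hdec⟩ := exists_oscillatory_decay ψ' sψ' cψ' ξ₀ hH'
  set r := min r₀ R with hr
  have hr0 : 0 < r := lt_min hr₀ hR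
  let a : ContDiffBump ξ₀ := ⟨r / 2, r, by positivity, by linarith⟩
  obtain ⟨C, hC⟩ := hdec a a.contDiff
    (a.tsupport_eq.subset.trans (Metric.closedBall_subset_closedBall (min_le_left _ _)))
  obtain ⟨K, hK, hbound⟩ := exists_weighted_bound sψ'.continuous a.continuous a.hasCompactSupport
    (fun ξ => a.nonneg) (rpow_mul_norm_surfaceKernel_le hC) hθ₀ hθ₁ hpθ hb
  refine ⟨r / 2, by positivity, ⟨K, hK⟩, fun f => ?_⟩
  have hfp : MemLp f (ENNReal.ofReal p) volume := f.memLp _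
  have hpr : (ENNReal.ofReal p).toReal = p := ENNReal.toReal_ofReal hp0.le
  have hpne : ENNReal.ofReal p ≠ 0 := by simpa using hp0
  have hfi : Integrable (fun x => ‖f x‖ ^ p) := by
    have := hfp.integrable_norm_rpow hpne ENNReal.ofReal_ne_top
    rwa [hpr] at this
  have h1 := hbound f f.continuous f.integrable hfi
  have hF : Continuous (𝓕 (f : EuclideanSpace ℝ (Fin (d + 1)) → ℂ)) :=
    continuous_fourier_of_integrable f.integrable
  have hi : Integrable (fun ξ => a ξ *
      ‖𝓕 (f : EuclideanSpace ℝ (Fin (d + 1)) → ℂ) (graphPoint ψ' ξ)‖ ^ 2) :=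
    (a.continuous.mul ((hF.comp (continuous_graphPoint
      sψ'.continuous)).norm.pow 2)).integrable_of_hasCompactSupport a.hasCompactSupport.mul_right
  calc ∫⁻ ξ in Metric.ball ξ₀ (r / 2),
        ‖𝓕 (f : EuclideanSpace ℝ (Fin (d + 1)) → ℂ) (graphPoint ψ ξ)‖ₑ ^ 2
      ≤ ∫⁻ ξ in Metric.ball ξ₀ (r / 2), ENNReal.ofReal (a ξ *
          ‖𝓕 (f : EuclideanSpace ℝ (Fin (d + 1)) → ℂ) (graphPoint ψ' ξ)‖ ^ 2) := by
        refine setLIntegral_mono' Metric.isOpen_ball.measurableSet fun ξ hξ => le_of_eq ?_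
        have h2 : a ξ = 1 := a.one_of_mem_closedBall (Metric.ball_subset_closedBall hξ)
        have h3 : graphPoint ψ' ξ = graphPoint ψ ξ := by
          rw [graphPoint, graphPoint, heq ξ]
          refine Metric.ball_subset_closedBall (Metric.ball_subset_ball ?_ hξ)
          linarith [min_le_right r₀ R]
        rw [h2, one_mul, h3, ENNReal.ofReal_pow (norm_nonneg _), ofReal_norm]
    _ ≤ ∫⁻ ξ, ENNReal.ofReal (a ξ *
          ‖𝓕 (f : EuclideanSpace ℝ (Fin (d + 1)) → ℂ) (graphPoint ψ' ξ)‖ ^ 2) :=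
        setLIntegral_le_lintegral _ _
    _ = ENNReal.ofReal (∫ ξ, a ξ *
          ‖𝓕 (f : EuclideanSpace ℝ (Fin (d + 1)) → ℂ) (graphPoint ψ' ξ)‖ ^ 2) := by
        rw [ofReal_integral_eq_lintegral_ofReal hi]
        exact .of_forall fun ξ => mul_nonneg a.nonneg (by positivity)
    _ ≤ ENNReal.ofReal (K * ((∫ x, ‖f x‖ ^ p) ^ (1 / p)) ^ 2) := ENNReal.ofReal_le_ofReal h1
    _ = _ := by
        rw [hfp.eLpNorm_eq_integral_rpow_norm hpne ENNReal.ofReal_ne_top, hpr,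
          ENNReal.ofReal_mul hK, ENNReal.ofReal_pow (by positivity), one_div,
          ENNReal.ofReal_eq_coe_nnreal hK]
        rfl

/-- The restriction estimate for bounded pieces of graphs with nondegenerate Hessian. -/
theorem graphEstimate_of_hessianNondegenerate {p : ℝ} (hp1 : 1 ≤ p)
    (hp : p ≤ steinTomasExponent (d + 1)) {U V : Set (EuclideanSpace ℝ (Fin d))}
    {ψ : EuclideanSpace ℝ (Fin d) → ℝ} (hUb : Bornology.IsBounded U) (hV : IsOpen V)
    (hUV : closure U ⊆ V) (hψ : ContDiffOn ℝ ∞ ψ V)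
    (hH : ∀ ξ ∈ closure U, HessianNondegenerate ψ ξ) :
    GraphEstimate ψ (ENNReal.ofReal p) U := by
  refine GraphEstimate.mono subset_closure (hUb.isCompact_closure.induction_on ?_
    (fun _ _ hst h => h.mono hst) (fun _ _ hs ht => hs.union ht) ?_)
  · exact ⟨0, fun f => by simp⟩
  · intro ξ hξ
    obtain ⟨r, hr, h⟩ := exists_ball_graphEstimate hp1 hp hV hψ (hUV hξ) (hH ξ hξ)
    exact ⟨_, mem_nhdsWithin_of_mem_nhds (Metric.ball_mem_nhds ξ hr), h⟩

end Graph

/-! ### The paraboloid and the hemispheres. -/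

section Examples

open scoped RealInnerProductSpace

variable {d : ℕ}

theorem paraboloid_eq_norm_sq :
    (paraboloid : EuclideanSpace ℝ (Fin d) → ℝ) = fun ξ => ‖ξ‖ ^ 2 := by
  ext ξ
  simp [paraboloid, EuclideanSpace.real_norm_sq_eq]

theorem hessianNondegenerate_paraboloid (ξ : EuclideanSpace ℝ (Fin d)) :
    HessianNondegenerate paraboloid ξ := by
  intro h hh
  ext k
  have h1 : (fun η : EuclideanSpace ℝ (Fin d) =>
      fderiv ℝ paraboloid η (EuclideanSpace.single k 1)) =
        ((2 : ℝ) • EuclideanSpace.proj k : EuclideanSpace ℝ (Fin d) →L[ℝ] ℝ) := by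
    ext η
    rw [paraboloid_eq_norm_sq, fderiv_norm_sq_apply]
    simp [EuclideanSpace.inner_single_right]
  have h2 := hh k
  rw [h1, ContinuousLinearMap.fderiv] at h2
  simpa using h2

theorem isBounded_openCube : Bornology.IsBounded (openCube d) := by
  refine (Metric.isBounded_closedBall (x := (0 : EuclideanSpace ℝ (Fin d))) (r := √d)).subset
    fun ξ hξ => ?_
  rw [mem_closedBall_zero_iff]
  refine Real.le_sqrt_of_sq_le ?_
  rw [EuclideanSpace.real_norm_sq_eq]
  calc ∑ i, ξ i ^ 2 ≤ ∑ _i : Fin d, (1 : ℝ) := by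
        refine Finset.sum_le_sum fun i _ => ?_
        rw [← sq_abs]
        exact pow_le_one₀ (abs_nonneg _) (hξ i).le
    _ = d := by simp

theorem one_sub_norm_sq_pos {ξ : EuclideanSpace ℝ (Fin d)} (hξ : ‖ξ‖ < 1) : 0 < 1 - ‖ξ‖ ^ 2 := by
  nlinarith [norm_nonneg ξ]

theorem hasFDerivAt_hemisphere {ξ : EuclideanSpace ℝ (Fin d)} (hξ : ‖ξ‖ < 1) :
    HasFDerivAt hemisphere (-(hemisphere ξ)⁻¹ • innerSL ℝ ξ) ξ := by
  have h1 : HasFDerivAt (fun η : EuclideanSpace ℝ (Fin d) => 1 - ‖η‖ ^ 2)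
      (-(2 • innerSL ℝ ξ)) ξ :=
    (hasStrictFDerivAt_norm_sq ξ).hasFDerivAt.const_sub 1
  have h2 : HasFDerivAt (hemisphere : EuclideanSpace ℝ (Fin d) → ℝ) _ ξ :=
    h1.sqrt (one_sub_norm_sq_pos hξ).ne'
  refine h2.congr_fderiv ?_
  ext v
  simp [hemisphere]
  ring

theorem hemisphere_pos {ξ : EuclideanSpace ℝ (Fin d)} (hξ : ‖ξ‖ < 1) : 0 < hemisphere ξ :=
  Real.sqrt_pos.2 (one_sub_norm_sq_pos hξ)

theorem contDiffOn_hemisphere :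
    ContDiffOn ℝ ∞ (hemisphere : EuclideanSpace ℝ (Fin d) → ℝ) (Metric.ball 0 1) := by
  refine ContDiffOn.sqrt ?_ fun ξ hξ => ?_
  · exact (contDiff_const.sub (contDiff_norm_sq ℝ)).contDiffOn
  · rw [mem_ball_zero_iff] at hξ
    exact (one_sub_norm_sq_pos hξ).ne'

/-- Pairing the kernel equation with `h` gives `‖h‖² / ψ + ⟪ξ, h⟫² / ψ³ = 0` with `ψ > 0`. Both
terms are nonnegative, so `h = 0`. -/
theorem hessianNondegenerate_hemisphere {ξ : EuclideanSpace ℝ (Fin d)} (hξ : ‖ξ‖ < 1) :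
    HessianNondegenerate hemisphere ξ := by
  intro h hh
  have hpos := hemisphere_pos hξ
  have h1 : ∀ k, h k * (hemisphere ξ)⁻¹ + ξ k * (⟪ξ, h⟫ * (hemisphere ξ)⁻¹ ^ 3) = 0 := by
    intro k
    have heq : (fun η : EuclideanSpace ℝ (Fin d) =>
        fderiv ℝ hemisphere η (EuclideanSpace.single k 1)) =ᶠ[nhds ξ]
          fun η => -((EuclideanSpace.proj k : EuclideanSpace ℝ (Fin d) →L[ℝ] ℝ) η *
            (hemisphere η)⁻¹) := by
      filter_upwards [Metric.isOpen_ball.mem_nhds (mem_ball_zero_iff.2 hξ)] with η hη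
      rw [(hasFDerivAt_hemisphere (mem_ball_zero_iff.1 hη)).fderiv]
      simp [EuclideanSpace.inner_single_right]
      ring
    have hd := ((EuclideanSpace.proj k : EuclideanSpace ℝ (Fin d) →L[ℝ] ℝ).hasFDerivAt
      (x := ξ)).mul ((hasDerivAt_inv hpos.ne').comp_hasFDerivAt ξ (hasFDerivAt_hemisphere hξ))
    have hd' : HasFDerivAt (fun η => -((EuclideanSpace.proj k : EuclideanSpace ℝ (Fin d) →L[ℝ] ℝ) η *
        (hemisphere η)⁻¹)) _ ξ := hd.neg
    have h2 := hh k
    rw [heq.fderiv_eq, hd'.fderiv] at h2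
    simp at h2
    linear_combination -h2
  have h2 : ‖h‖ ^ 2 * (hemisphere ξ)⁻¹ + ⟪ξ, h⟫ ^ 2 * (hemisphere ξ)⁻¹ ^ 3 = 0 := by
    have h3 : ∑ k, h k * (h k * (hemisphere ξ)⁻¹ + ξ k * (⟪ξ, h⟫ * (hemisphere ξ)⁻¹ ^ 3)) = 0 :=
      Finset.sum_eq_zero fun k _ => by rw [h1, mul_zero]
    have h4 : ‖h‖ ^ 2 = ∑ k, h k ^ 2 := EuclideanSpace.real_norm_sq_eq h
    have h5 : ⟪ξ, h⟫ = ∑ k, h k * ξ k := by simp [PiLp.inner_apply]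
    rw [sq ⟪ξ, h⟫]
    nth_rewrite 1 [h5]
    rw [h4, Finset.sum_mul, Finset.sum_mul, Finset.sum_mul, ← Finset.sum_add_distrib, ← h3]
    refine Finset.sum_congr rfl fun k _ => ?_
    ring
  have h3 : ‖h‖ ^ 2 * (hemisphere ξ)⁻¹ = 0 := by
    have h4 : 0 ≤ ⟪ξ, h⟫ ^ 2 * (hemisphere ξ)⁻¹ ^ 3 := by positivity
    have h5 : 0 ≤ ‖h‖ ^ 2 * (hemisphere ξ)⁻¹ := by positivity
    linarith
  have h4 := (mul_eq_zero.1 h3).resolve_right (inv_ne_zero hpos.ne')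
  simpa using h4

theorem graphEstimate_hemisphere_closedBall {p : ℝ} (hp1 : 1 ≤ p)
    (hp : p ≤ steinTomasExponent (d + 1)) {ρ : ℝ} (hρ : ρ < 1)
    {s : Set (EuclideanSpace ℝ (Fin d))} (hs : s ⊆ Metric.closedBall 0 ρ) :
    GraphEstimate hemisphere (ENNReal.ofReal p) s := by
  have hcl : closure s ⊆ Metric.ball 0 1 :=
    (closure_minimal hs Metric.isClosed_closedBall).trans (Metric.closedBall_subset_ball hρ)
  exact graphEstimate_of_hessianNondegenerate hp1 hp (Metric.isBounded_closedBall.subset hs)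
    Metric.isOpen_ball hcl contDiffOn_hemisphere
    fun ξ hξ => hessianNondegenerate_hemisphere (mem_ball_zero_iff.1 (hcl hξ))

/-- Transfer of the estimate between graphs that are related by a linear isometry. -/
theorem GraphEstimate.transfer {ψ ψ' : EuclideanSpace ℝ (Fin d) → ℝ} {p : ℝ≥0∞}
    {s t : Set (EuclideanSpace ℝ (Fin d))} (h : GraphEstimate ψ p s) (hs : MeasurableSet s)
    (L : EuclideanSpace ℝ (Fin (d + 1)) ≃ₗᵢ[ℝ] EuclideanSpace ℝ (Fin (d + 1)))
    (Φ : EuclideanSpace ℝ (Fin d) → EuclideanSpace ℝ (Fin d)) (K : ℝ≥0)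
    (hK : volume.restrict t ≤ K • (volume.restrict s).map Φ)
    (hL : ∀ η ∈ s, graphPoint ψ' (Φ η) = L (graphPoint ψ η)) : GraphEstimate ψ' p t := by
  obtain ⟨C, hC⟩ := h
  refine ⟨K * C, fun f => ?_⟩
  set g : 𝓢(EuclideanSpace ℝ (Fin (d + 1)), ℂ) :=
    SchwartzMap.compCLMOfContinuousLinearEquiv ℂ L.toContinuousLinearEquiv f with hg
  have hgf : (g : EuclideanSpace ℝ (Fin (d + 1)) → ℂ) = f ∘ L := rfl
  have hnorm : eLpNorm (g : EuclideanSpace ℝ (Fin (d + 1)) → ℂ) p volume =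
      eLpNorm (f : EuclideanSpace ℝ (Fin (d + 1)) → ℂ) p volume := by
    rw [hgf]
    exact eLpNorm_comp_measurePreserving (ν := volume) f.continuous.aestronglyMeasurable
      L.measurePreserving
  have hF : ∀ ζ, 𝓕 (g : EuclideanSpace ℝ (Fin (d + 1)) → ℂ) ζ =
      𝓕 (f : EuclideanSpace ℝ (Fin (d + 1)) → ℂ) (L ζ) := fun ζ => by
    rw [hgf]
    exact Real.fourier_comp_linearIsometry L _ ζ
  calc ∫⁻ ξ in t, ‖𝓕 (f : EuclideanSpace ℝ (Fin (d + 1)) → ℂ) (graphPoint ψ' ξ)‖ₑ ^ 2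
      ≤ ∫⁻ ξ, ‖𝓕 (f : EuclideanSpace ℝ (Fin (d + 1)) → ℂ) (graphPoint ψ' ξ)‖ₑ ^ 2
          ∂(K • (volume.restrict s).map Φ) := lintegral_mono' hK le_rfl
    _ = K * ∫⁻ ξ, ‖𝓕 (f : EuclideanSpace ℝ (Fin (d + 1)) → ℂ) (graphPoint ψ' ξ)‖ₑ ^ 2
          ∂((volume.restrict s).map Φ) := by
        rw [lintegral_smul_measure]
        rfl
    _ ≤ K * ∫⁻ η in s,
          ‖𝓕 (f : EuclideanSpace ℝ (Fin (d + 1)) → ℂ) (graphPoint ψ' (Φ η))‖ₑ ^ 2 := by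
        exact mul_le_mul' le_rfl (lintegral_map_le
          (fun ξ => ‖𝓕 (f : EuclideanSpace ℝ (Fin (d + 1)) → ℂ) (graphPoint ψ' ξ)‖ₑ ^ 2) Φ)
    _ = K * ∫⁻ η in s, ‖𝓕 (g : EuclideanSpace ℝ (Fin (d + 1)) → ℂ) (graphPoint ψ η)‖ₑ ^ 2 := by
        congr 1
        refine setLIntegral_congr_fun hs fun η hη => ?_
        simp only [hL η hη, hF]
    _ ≤ K * (C * eLpNorm (g : EuclideanSpace ℝ (Fin (d + 1)) → ℂ) p volume ^ 2) := by
        gcongr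
        exact hC g
    _ = _ := by
        rw [hnorm, ENNReal.coe_mul, mul_assoc]

/-- A Lipschitz map enlarges Lebesgue measure at most by a power of its Lipschitz constant. -/
theorem volume_image_le_of_lipschitzOnWith {K : ℝ≥0}
    {Φ : EuclideanSpace ℝ (Fin d) → EuclideanSpace ℝ (Fin d)} {s : Set (EuclideanSpace ℝ (Fin d))}
    (h : LipschitzOnWith K Φ s) : volume (Φ '' s) ≤ ((K ^ d : ℝ≥0) : ℝ≥0∞) * volume s := by
  -- Lebesgue measure is a constant multiple of `d`-dimensional Hausdorff measure, for which the
  -- Lipschitz bound is available.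
  have hH : (Measure.hausdorffMeasure (d : ℝ) :
      Measure (EuclideanSpace ℝ (Fin d))).IsAddHaarMeasure := by
    simpa using isAddHaarMeasure_hausdorffMeasure (E := EuclideanSpace ℝ (Fin d))
  have h1 := h.hausdorffMeasure_image_le (d := d) (Nat.cast_nonneg d)
  rw [Measure.isAddLeftInvariant_eq_smul (volume : Measure (EuclideanSpace ℝ (Fin d)))
    (Measure.hausdorffMeasure (d : ℝ))]
  simp only [Measure.smul_apply, ENNReal.smul_def, smul_eq_mul]
  calc _ ≤ _ * ((K : ℝ≥0∞) ^ (d : ℝ) * Measure.hausdorffMeasure (d : ℝ) s) := by gcongr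
    _ = _ := by
      rw [ENNReal.rpow_natCast, ENNReal.coe_pow]
      ring

theorem restrict_le_smul_map_of_lipschitzOnWith {K : ℝ≥0}
    {Φ : EuclideanSpace ℝ (Fin d) → EuclideanSpace ℝ (Fin d)}
    {s t : Set (EuclideanSpace ℝ (Fin d))} (hΦ : Measurable Φ) (h : LipschitzOnWith K Φ s)
    (hst : t ⊆ Φ '' s) :
    volume.restrict t ≤ (K ^ d : ℝ≥0) • (volume.restrict s).map Φ := by
  refine Measure.le_iff.2 fun A hA => ?_
  rw [Measure.restrict_apply hA, Measure.smul_apply, Measure.map_apply hΦ hA,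
    Measure.restrict_apply (hΦ hA), ENNReal.smul_def, smul_eq_mul]
  refine (measure_mono ?_).trans
    (volume_image_le_of_lipschitzOnWith (h.mono (Set.inter_subset_right (s := Φ ⁻¹' A))))
  rintro ξ ⟨hξA, hξt⟩
  obtain ⟨η, hη, rfl⟩ := hst hξt
  exact ⟨η, ⟨hξA, hη⟩, rfl⟩

/-- The map that replaces the `i`-th coordinate `ξ i` by `v`. -/
def replaceCoord (i : Fin d) (v : ℝ) (ξ : EuclideanSpace ℝ (Fin d)) : EuclideanSpace ℝ (Fin d) :=
  WithLp.toLp 2 (Function.update ξ i v)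

theorem norm_sq_replaceCoord (i : Fin d) (v : ℝ) (ξ : EuclideanSpace ℝ (Fin d)) :
    ‖replaceCoord i v ξ‖ ^ 2 = ‖ξ‖ ^ 2 - ξ i ^ 2 + v ^ 2 := by
  rw [EuclideanSpace.real_norm_sq_eq, EuclideanSpace.real_norm_sq_eq,
    ← Finset.add_sum_erase _ _ (Finset.mem_univ i),
    ← Finset.add_sum_erase Finset.univ (fun j => ξ j ^ 2) (Finset.mem_univ i)]
  have : ∑ x ∈ Finset.univ.erase i, replaceCoord i v ξ x ^ 2 =
      ∑ x ∈ Finset.univ.erase i, ξ x ^ 2 := by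
    refine Finset.sum_congr rfl fun j hj => ?_
    simp [replaceCoord, Function.update_of_ne (Finset.ne_of_mem_erase hj)]
  rw [this]
  simp [replaceCoord]
  ring

/-- The restriction estimate for the part of the hemisphere on which the `i`-th coordinate is
bounded away from zero and has a given sign. -/
theorem graphEstimate_hemisphere_sideCap {p : ℝ} (hp1 : 1 ≤ p)
    (hp : p ≤ steinTomasExponent (d + 1)) (i : Fin d) (σ : ℝ ≃ₗᵢ[ℝ] ℝ) {ρ : ℝ} (hρ : ρ < 1)
    (hρ0 : 0 ≤ ρ) :
    GraphEstimate hemisphere (ENNReal.ofReal p)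
      {ξ : EuclideanSpace ℝ (Fin d) | ‖ξ‖ < 1 ∧ 1 - ξ i ^ 2 ≤ ρ ^ 2 ∧ σ |ξ i| = ξ i} := by
  have hσ : ∀ x, σ x ^ 2 = x ^ 2 := fun x => by
    rw [← sq_abs, ← Real.norm_eq_abs, σ.norm_map, Real.norm_eq_abs, sq_abs]
  -- `Φ` is the base map of the isometry `L` that swaps the `i`-th and vertical coordinates of the
  -- sphere and then applies the sign `σ` to the `i`-th one. On `‖η‖ ≤ ρ < 1` it is Lipschitz, so
  -- Lebesgue measure on the side cap is controlled by its pushforward.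
  set Φ : EuclideanSpace ℝ (Fin d) → EuclideanSpace ℝ (Fin d) := fun η =>
    replaceCoord i (σ (hemisphere η)) η with hΦ
  have hc : Continuous (hemisphere : EuclideanSpace ℝ (Fin d) → ℝ) := by
    unfold hemisphere
    fun_prop
  have hΦc : Continuous Φ := by
    refine (PiLp.continuous_toLp 2 _).comp (Continuous.update (by fun_prop) i ?_)
    exact σ.continuous.comp hc
  set s : Set (EuclideanSpace ℝ (Fin d)) := {η | ‖η‖ ≤ ρ ∧ 0 < η i} with hs
  have hsm : MeasurableSet s := by
    have h1 : IsClosed {η : EuclideanSpace ℝ (Fin d) | ‖η‖ ≤ ρ} :=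
      isClosed_le continuous_norm continuous_const
    have h2 : IsOpen {η : EuclideanSpace ℝ (Fin d) | 0 < η i} :=
      isOpen_lt continuous_const (by fun_prop)
    exact h1.measurableSet.inter h2.measurableSet
  have hsq : ∀ {η : EuclideanSpace ℝ (Fin d)}, ‖η‖ ≤ 1 → hemisphere η ^ 2 = 1 - ‖η‖ ^ 2 := by
    intro η hη
    exact Real.sq_sqrt (by nlinarith [norm_nonneg η])
  obtain ⟨K, hK⟩ : ∃ K, LipschitzOnWith K Φ s := by
    have hloc : LocallyLipschitzOn (Metric.closedBall 0 ρ) Φ := by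
      intro η hη
      have hη' : η ∈ Metric.ball (0 : EuclideanSpace ℝ (Fin d)) 1 :=
        Metric.closedBall_subset_ball hρ hη
      have h1 : ContDiffAt ℝ 1 (hemisphere : EuclideanSpace ℝ (Fin d) → ℝ) η :=
        (contDiffOn_hemisphere.contDiffAt (Metric.isOpen_ball.mem_nhds hη')).of_le (by simp)
      have h2 : ContDiffAt ℝ 1 Φ η := by
        rw [contDiffAt_euclidean]
        intro j
        rcases eq_or_ne j i with rfl | hj
        · simp only [hΦ, replaceCoord, Function.update_self]
          exact σ.toContinuousLinearEquiv.contDiff.contDiffAt.comp η h1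
        · simp only [hΦ, replaceCoord, Function.update_of_ne hj]
          fun_prop
      obtain ⟨K, t, ht, hKt⟩ := h2.exists_lipschitzOnWith
      exact ⟨K, t, mem_nhdsWithin_of_mem_nhds ht, hKt⟩
    obtain ⟨K, hK⟩ := hloc.exists_lipschitzOnWith_of_compact (isCompact_closedBall _ _)
    exact ⟨K, hK.mono fun η hη => mem_closedBall_zero_iff.2 hη.1⟩
  let L : EuclideanSpace ℝ (Fin (d + 1)) ≃ₗᵢ[ℝ] EuclideanSpace ℝ (Fin (d + 1)) :=
    (LinearIsometryEquiv.piLpCongrLeft 2 ℝ ℝ (Equiv.swap i.castSucc (Fin.last d))).trans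
      (LinearIsometryEquiv.piLpCongrRight 2
        fun j => if j = i.castSucc then σ else LinearIsometryEquiv.refl ℝ ℝ)
  refine GraphEstimate.transfer (graphEstimate_hemisphere_closedBall hp1 hp hρ (s := s)
    fun η hη => mem_closedBall_zero_iff.2 hη.1) hsm L Φ (K ^ d)
    (restrict_le_smul_map_of_lipschitzOnWith hΦc.measurable hK ?_) ?_
  · rintro ξ ⟨hξ1, hξρ, hξσ⟩
    have hn : ‖replaceCoord i (hemisphere ξ) ξ‖ ^ 2 = 1 - ξ i ^ 2 := by
      rw [norm_sq_replaceCoord, hsq hξ1.le]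
      ring
    refine ⟨replaceCoord i (hemisphere ξ) ξ, ⟨?_, ?_⟩, ?_⟩
    · exact (sq_le_sq₀ (norm_nonneg _) hρ0).1 (hn.le.trans hξρ)
    · simpa [replaceCoord] using hemisphere_pos hξ1
    · have h1 : hemisphere (replaceCoord i (hemisphere ξ) ξ) = |ξ i| := by
        rw [hemisphere, hn, sub_sub_cancel, Real.sqrt_sq_eq_abs]
      simp only [hΦ]
      rw [h1, hξσ]
      simp [replaceCoord]
  · rintro η ⟨hη1, hη0⟩
    have hn : ‖Φ η‖ ^ 2 = 1 - η i ^ 2 := by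
      rw [hΦ, norm_sq_replaceCoord, hσ, hsq (hη1.trans hρ.le)]
      ring
    have h1 : hemisphere (Φ η) = η i := by
      rw [hemisphere, hn, sub_sub_cancel, Real.sqrt_sq hη0.le]
    ext j
    refine Fin.lastCases ?_ (fun k => ?_) j
    · rw [graphPoint_last, h1]
      have : Fin.last d ≠ i.castSucc := (Fin.castSucc_lt_last i).ne'
      simp [L, this, graphPoint]
    · rcases eq_or_ne k i with rfl | hk
      · simp [L, graphPoint, hΦ, replaceCoord]
      · have h3 : k.castSucc ≠ i.castSucc := fun h => hk (Fin.castSucc_injective _ h)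
        have h4 : k.castSucc ≠ Fin.last d := (Fin.castSucc_lt_last k).ne
        simp [L, graphPoint, hΦ, replaceCoord, hk, Equiv.swap_apply_of_ne_of_ne h3 h4]

theorem GraphEstimate.iUnion {ψ : EuclideanSpace ℝ (Fin d) → ℝ} {p : ℝ≥0∞} {ι : Type*} [Fintype ι]
    {s : ι → Set (EuclideanSpace ℝ (Fin d))} (h : ∀ i, GraphEstimate ψ p (s i)) :
    GraphEstimate ψ p (⋃ i, s i) := by
  choose C hC using h
  refine ⟨∑ i, C i, fun f => (lintegral_iUnion_le s _).trans ?_⟩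
  rw [tsum_fintype, ENNReal.ofNNReal_finsetSum, Finset.sum_mul]
  exact Finset.sum_le_sum fun i _ => hC i f

theorem graphEstimate_hemisphere {p : ℝ} (hp1 : 1 ≤ p) (hp : p ≤ steinTomasExponent (d + 1)) :
    GraphEstimate hemisphere (ENNReal.ofReal p)
      (Metric.ball (0 : EuclideanSpace ℝ (Fin d)) 1) := by
  -- This value satisfies `d * (1 - ρ²) = ρ²`: if all `d` squared coordinates were below `1 - ρ²`,
  -- then `‖ξ‖ ≤ ρ`. So the inner ball and the `2d` side caps cover the unit ball.
  set ρ : ℝ := √(d / (d + 1)) with hρ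
  have hρsq : ρ ^ 2 = d / (d + 1) := Real.sq_sqrt (by positivity)
  have hρ1 : ρ < 1 := by
    rw [hρ, Real.sqrt_lt' one_pos, div_lt_iff₀ (by positivity)]
    linarith
  have hρ0 : 0 ≤ ρ := Real.sqrt_nonneg _
  let σ : Bool → ℝ ≃ₗᵢ[ℝ] ℝ := fun b =>
    if b then LinearIsometryEquiv.neg ℝ else LinearIsometryEquiv.refl ℝ ℝ
  refine GraphEstimate.mono ?_
    ((graphEstimate_hemisphere_closedBall hp1 hp hρ1 subset_rfl).union
      (GraphEstimate.iUnion fun q : Fin d × Bool =>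
        graphEstimate_hemisphere_sideCap hp1 hp q.1 (σ q.2) hρ1 hρ0))
  intro ξ hξ
  rw [mem_ball_zero_iff] at hξ
  rcases le_or_gt ‖ξ‖ ρ with h | h
  · exact Or.inl (mem_closedBall_zero_iff.2 h)
  · right
    obtain ⟨i, hi⟩ : ∃ i, 1 - ξ i ^ 2 ≤ ρ ^ 2 := by
      by_contra! hlt
      have h1 : ‖ξ‖ ^ 2 ≤ ∑ _i : Fin d, (1 - ρ ^ 2) := by
        rw [EuclideanSpace.real_norm_sq_eq]
        exact Finset.sum_le_sum fun i _ => by linarith [hlt i]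
      have h2 : ∑ _i : Fin d, (1 - ρ ^ 2) = ρ ^ 2 := by
        rw [Finset.sum_const, Finset.card_univ, Fintype.card_fin, nsmul_eq_mul, hρsq]
        field_simp
        ring
      have h3 : ρ ^ 2 < ‖ξ‖ ^ 2 := by gcongr
      linarith
    rw [Set.mem_iUnion]
    rcases le_or_gt 0 (ξ i) with h0 | h0
    · exact ⟨(i, false), hξ, hi, by simp [σ, abs_of_nonneg h0]⟩
    · exact ⟨(i, true), hξ, hi, by simp [σ, abs_of_neg h0]⟩

theorem graphEstimate_neg_hemisphere {p : ℝ} (hp1 : 1 ≤ p)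
    (hp : p ≤ steinTomasExponent (d + 1)) :
    GraphEstimate (fun ξ => -hemisphere ξ) (ENNReal.ofReal p)
      (Metric.ball (0 : EuclideanSpace ℝ (Fin d)) 1) := by
  let L : EuclideanSpace ℝ (Fin (d + 1)) ≃ₗᵢ[ℝ] EuclideanSpace ℝ (Fin (d + 1)) :=
    LinearIsometryEquiv.piLpCongrRight 2
      fun j => if j = Fin.last d then LinearIsometryEquiv.neg ℝ else LinearIsometryEquiv.refl ℝ ℝ
  refine (graphEstimate_hemisphere hp1 hp).transfer Metric.isOpen_ball.measurableSet L id 1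
    (by rw [Measure.map_id, one_smul]) fun η _ => ?_
  ext j
  refine Fin.lastCases ?_ (fun k => ?_) j
  · simp [L, graphPoint]
  · simp [L, graphPoint, (Fin.castSucc_lt_last k).ne]

end Examples

end FourierRestriction

theorem mainTheorem4 (d : ℕ) (p : ℝ) (hp1 : 1 ≤ p)
    (hp : p ≤ FourierRestriction.steinTomasExponent (d + 1)) :
    -- the truncated paraboloid
    FourierRestriction.RestrictionEstimate
      (FourierRestriction.graphMeasure (FourierRestriction.openCube d)
        FourierRestriction.paraboloid)
      (ENNReal.ofReal p) 2 ∧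
    -- the two open hemispheres of the unit sphere
    FourierRestriction.RestrictionEstimate
      (FourierRestriction.graphMeasure (Metric.ball (0 : EuclideanSpace ℝ (Fin d)) 1)
        FourierRestriction.hemisphere)
      (ENNReal.ofReal p) 2 ∧
    FourierRestriction.RestrictionEstimate
      (FourierRestriction.graphMeasure (Metric.ball (0 : EuclideanSpace ℝ (Fin d)) 1)
        (fun ξ => -FourierRestriction.hemisphere ξ))
      (ENNReal.ofReal p) 2 ∧
    -- smooth graphs whose Gaussian curvature vanishes nowhere, up to the boundary
    ∀ (U V : Set (EuclideanSpace ℝ (Fin d))) (ψ : EuclideanSpace ℝ (Fin d) → ℝ),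
      MeasurableSet U → Bornology.IsBounded U → IsOpen V → closure U ⊆ V →
      ContDiffOn ℝ ∞ ψ V →
      (∀ ξ ∈ closure U, FourierRestriction.gaussianCurvature ψ ξ ≠ 0) →
      FourierRestriction.RestrictionEstimate (FourierRestriction.graphMeasure U ψ)
        (ENNReal.ofReal p) 2 := by
  refine ⟨?_, ?_, ?_, ?_⟩
  · refine FourierRestriction.restrictionEstimate_graphMeasure
      (FourierRestriction.graphEstimate_of_hessianNondegenerate hp1 hp
        FourierRestriction.isBounded_openCube isOpen_univ (Set.subset_univ _) ?_
        fun ξ _ => FourierRestriction.hessianNondegenerate_paraboloid ξ)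
    rw [FourierRestriction.paraboloid_eq_norm_sq]
    exact (contDiff_norm_sq ℝ).contDiffOn
  · exact FourierRestriction.restrictionEstimate_graphMeasure
      (FourierRestriction.graphEstimate_hemisphere hp1 hp)
  · exact FourierRestriction.restrictionEstimate_graphMeasure
      (FourierRestriction.graphEstimate_neg_hemisphere hp1 hp)
  · intro U V ψ _ hUb hV hUV hψ hcurv
    refine FourierRestriction.restrictionEstimate_graphMeasure
      (FourierRestriction.graphEstimate_of_hessianNondegenerate hp1 hp hUb hV hUV hψ fun ξ hξ => ?_)
    refine FourierRestriction.hessianNondegenerate_of_det_ne_zero fun h0 => hcurv ξ hξ ?_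
    rw [FourierRestriction.gaussianCurvature, h0, zero_div]
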